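/- Let $k$ be a $p$-adic field (a nonarchimedean local field of characteristic $0$) with ring of integers $\mathcal O_k$, prime element $\pi$, residue cardinality $q$, absolute value normalized by $|\pi|=q^{-1}$, and put $e=v_\pi(2)$. Let $k'/k$ be an unramified quadratic extension with ring of integers $\mathcal O_{k'}$, write $a^*$ for the conjugate transpose of a matrix over $k'$, and fix a unit $\varepsilon\in\mathcal O_k^\times$ such that $\{1,\frac{1+\sqrt\varepsilon}{2}\}$ is an $\mathcal O_k$-basis of $\mathcal O_{k'}$. Let $j\in GL_3(k)$ be the matrix with anti-diagonal entries $1$ and other entries $0$, and set $$G=\{g\in GL_3(k')\mid g^*jg=j\},\quad K=G\cap GL_3(\mathcal O_{k'}),\quad X=\{x\in G\mid x^*=x,\ \Phi_{xj}(t)=\Phi_j(t)\},$$ where $\Phi_y$ is the characteristic polynomial of $y$ and $G$ acts on $X$ by $g\cdot x=gxg^*$. For $\lambda\in\mathbb Z$, $\lambda\ge -e$, let $$x_\lambda=\begin{pmatrix}\pi^\lambda&0&0\\0&1&0\\0&0&\pi^{-\lambda}\end{pmatrix}\ (\lambda\ge0),\qquad x_\lambda=\begin{pmatrix}\pi^\lambda(1-\varepsilon)&0&-\sqrt\varepsilon\\0&1&0\\\sqrt\varepsilon&0&\pi^{-\lambda}\end{pmatrix}\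 (\lambda<0).$$ For $x\in X$ and $s\in\mathbb C$ with $\operatorname{Re}s\ge0$ put $$\omega(x;s)=\int_K|d_1(h\cdot x)|^s\,dh,$$ where $d_1(y)$ is the lower right entry of $y$, the integrand is $0$ where $d_1=0$, and $dh$ is the Haar measure of total mass $1$ on $K$. Write $\omega(x;z)$ for the continuation of this integral to a rational function of $q^s$, taken at $s=-z-1+\frac{\pi\sqrt{-1}}{2\log q}$ (here $\pi=3.14\ldots$), $z\in\mathbb C$. Assume $e\le1$. Then for every $x\in X$ the integral converges absolutely for $\operatorname{Re}s\ge0$ and has a unique continuation to a rational function of $q^s$. For every integer $\lambda\ge-e$ one has $x_\lambda\in X$ and $$\omega(x_\lambda;z)=\frac{\sqrt{-1}^{\,\lambda}q^{-\lambda}q^{ez}(1-q^{-1+2z})}{(1+q^{-3})(1+q^{2z})}\left(\frac{q^{-(\lambda+e)z}(1+q^{-2+2z})}{1-q^{2z}}+\frac{q^{(\lambda+e)z}(1+q^{-2-2z})}{1-q^{-2z}}\right)$$ for all $z$ with $q^{2z}\ne\pm1$. In particular, for every $x\in X$, $$\frac{q^{-ez}(1+q^{2z})}{1-q^{-1+2z}}\,\omega(x;z)\in\mathbb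 C[q^z+q^{-z}],\qquad \omega(x;z)=q^{2ez}\frac{1-q^{-1+2z}}{q^{2z}-q^{-1}}\,\omega(x;-z),$$ the first as an identity with a fixed polynomial in $q^z+q^{-z}$ for all $z$ with $q^{2z}\ne-1$ and $q^{2z}\ne q$, the second for all $z$ with $q^{2z}\ne-1$ and $q^{2z}\ne q^{-1}$. -/

import Mathlib

open MeasureTheory

namespace UnitaryHermitian

/-- The ring of integers of a nonarchimedean normed field. -/
noncomputable abbrev integers (F : Type*) [NontriviallyNormedField F] [IsUltrametricDist F] :
    ValuationSubring F :=
  (NormedField.valuation (K := F)).valuationSubring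

/-- The cardinality of the residue class field. -/
noncomputable def residueCard (F : Type*) [NontriviallyNormedField F] [IsUltrametricDist F] : ℕ :=
  Nat.card (IsLocalRing.ResidueField (integers F))

/-- The matrix with all anti-diagonal entries `1` and the other entries `0`. -/
def antidiag (m : ℕ) (R : Type*) [Zero R] [One R] : Matrix (Fin m) (Fin m) R :=
  Matrix.of fun i j => if j = i.rev then 1 else 0

section Groups

variable {k k' : Type*} [NontriviallyNormedField k] [NormedField k'] [NormedAlgebra k k']

/-- The conjugate transpose with respect to the `k`-automorphism `σ` of `k'`. -/
def conjTr (σ : k' ≃ₐ[k] k') {m : ℕ} (a : Matrix (Fin m) (Fin m) k') :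
    Matrix (Fin m) (Fin m) k' :=
  (a.map σ).transpose

theorem conjTr_mul (σ : k' ≃ₐ[k] k') {m : ℕ} (a b : Matrix (Fin m) (Fin m) k') :
    conjTr σ (a * b) = conjTr σ b * conjTr σ a := by
  simp [conjTr, Matrix.map_mul, Matrix.transpose_mul]

theorem conjTr_one (σ : k' ≃ₐ[k] k') {m : ℕ} :
    conjTr σ (1 : Matrix (Fin m) (Fin m) k') = 1 := by
  simp [conjTr]

/-- The unitary group `{g ∈ GL_m(k') | g* j g = j}` of the matrix `j = antidiag m k'`. -/
def unitaryGroup (σ : k' ≃ₐ[k] k') (m : ℕ) : Subgroup (GL (Fin m) k') where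
  carrier := {g | conjTr σ g.val * antidiag m k' * g.val = antidiag m k'}
  one_mem' := by simp [conjTr_one]
  mul_mem' := by
    intro a b ha hb
    simp only [Set.mem_ofPred_eq, Units.val_mul, conjTr_mul] at *
    calc _ = conjTr σ b.val * (conjTr σ a.val * antidiag m k' * a.val) * b.val := by
          simp only [Matrix.mul_assoc]
      _ = _ := by rw [ha, hb]
  inv_mem' := by
    intro a ha
    simp only [Set.mem_ofPred_eq] at *
    have h : a.val * (a⁻¹).val = 1 := a.mul_inv
    have h2 : conjTr σ (a⁻¹).val * conjTr σ a.val = 1 := by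
      rw [← conjTr_mul, h, conjTr_one]
    calc _ = conjTr σ (a⁻¹).val * (conjTr σ a.val * antidiag m k' * a.val) * (a⁻¹).val := by
          rw [ha]
      _ = (conjTr σ (a⁻¹).val * conjTr σ a.val) * antidiag m k' * (a.val * (a⁻¹).val) := by
          simp only [Matrix.mul_assoc]
      _ = _ := by rw [h, h2, Matrix.one_mul, Matrix.mul_one]

/-- The elements of the unitary group which are hermitian, with the same characteristic
polynomial condition `Φ_{xj}(t) = Φ_j(t)`. Invertibility of `x` follows from `x* j x = j`. -/
def hermitianSpace (σ : k' ≃ₐ[k] k') (m : ℕ) : Set (Matrix (Fin m) (Fin m) k') :=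
  {x | conjTr σ x * antidiag m k' * x = antidiag m k' ∧ conjTr σ x = x ∧
    (x * antidiag m k').charpoly = (antidiag m k').charpoly}

/-- The action `g · x = g x g*`. -/
def act (σ : k' ≃ₐ[k] k') {m : ℕ} (g : GL (Fin m) k') (x : Matrix (Fin m) (Fin m) k') :
    Matrix (Fin m) (Fin m) k' :=
  g.val * x * conjTr σ g.val

theorem norm_mul_apply_le_one [IsUltrametricDist k'] {m : ℕ} {a b : Matrix (Fin m) (Fin m) k'}
    (ha : ∀ i j, ‖a i j‖ ≤ 1) (hb : ∀ i j, ‖b i j‖ ≤ 1) (i j : Fin m) : ‖(a * b) i j‖ ≤ 1 := by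
  rw [Matrix.mul_apply]
  refine IsUltrametricDist.norm_sum_le_of_forall_le_of_nonneg zero_le_one fun l _ => ?_
  rw [norm_mul]
  exact mul_le_one₀ (ha i l) (norm_nonneg _) (hb l j)

theorem norm_one_apply_le_one {m : ℕ} (i j : Fin m) :
    ‖(1 : Matrix (Fin m) (Fin m) k') i j‖ ≤ 1 := by
  rw [Matrix.one_apply]
  split_ifs <;> simp

/-- The maximal compact subgroup: the elements `g` of the unitary group such that `g` and
`g⁻¹` have integral entries, i.e. the intersection of the unitary group with `GL_m(𝒪_{k'})`. -/
def maxCompact [IsUltrametricDist k'] (σ : k' ≃ₐ[k] k') (m : ℕ) : Subgroup (GL (Fin m) k') where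
  carrier := {g | g ∈ unitaryGroup σ m ∧ (∀ i j, ‖g.val i j‖ ≤ 1) ∧ ∀ i j, ‖(g⁻¹).val i j‖ ≤ 1}
  one_mem' := by
    refine ⟨one_mem _, ?_, ?_⟩
    · simpa using norm_one_apply_le_one (k' := k') (m := m)
    · simpa using norm_one_apply_le_one (k' := k') (m := m)
  mul_mem' := by
    rintro a b ⟨ha, ha1, ha2⟩ ⟨hb, hb1, hb2⟩
    refine ⟨mul_mem ha hb, ?_, ?_⟩
    · simpa using norm_mul_apply_le_one ha1 hb1
    · rw [mul_inv_rev]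
      exact norm_mul_apply_le_one hb2 ha2
  inv_mem' := by
    rintro a ⟨ha, ha1, ha2⟩
    refine ⟨inv_mem ha, ha2, ?_⟩
    simpa using ha1

/-- The representatives `x_λ` in size `3`, where `ϖ` is a prime element of `k`, `ε` a unit of `k`
and `rε` a square root of `ε` in `k'`. -/
noncomputable def xRep (ϖ ε : k) (rε : k') (l : ℤ) : Matrix (Fin 3) (Fin 3) k' :=
  if 0 ≤ l then
    !![algebraMap k k' (ϖ ^ l), 0, 0;
       0, 1, 0;
       0, 0, algebraMap k k' (ϖ ^ (-l))]
  else
    !![algebraMap k k' (ϖ ^ l * (1 - ε)), 0, -rε;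
       0, 1, 0;
       rε, 0, algebraMap k k' (ϖ ^ (-l))]

end Groups

section Spherical

variable {k k' : Type*} [NontriviallyNormedField k] [IsUltrametricDist k]
  [NormedField k'] [IsUltrametricDist k'] [NormedAlgebra k k']

/-- The function `|d₁(y)|^s`, extended by `0` to `d₁(y) = 0`, in size `3`; here `d₁(y)` is the lower
right entry of `y`. -/
noncomputable def absPow (y : Matrix (Fin 3) (Fin 3) k') (s : ℂ) : ℂ :=
  open Classical in if y 2 2 = 0 then 0 else ((‖y 2 2‖ : ℝ) : ℂ) ^ s

/-- `R` is the continuation of the integral `∫_K |d₁(h · x)|^s dh` as a rational function of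
`q^s`: for `Re s ≥ 0` it has no pole at `q^s`, and its value there is the integral. -/
def IsContinuation (σ : k' ≃ₐ[k] k') [MeasurableSpace (maxCompact σ 3)]
    (μ : Measure (maxCompact σ 3)) (x : Matrix (Fin 3) (Fin 3) k') (R : RatFunc ℂ) : Prop :=
  ∀ s : ℂ, 0 ≤ s.re →
    R.denom.eval ((residueCard k : ℂ) ^ s) ≠ 0 ∧
    R.eval (RingHom.id ℂ) ((residueCard k : ℂ) ^ s) =
      ∫ h : maxCompact σ 3, absPow (act σ (h : GL (Fin 3) k') x) s ∂μ

open Classical in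
/-- The spherical function of `x` as a rational function of `q^s` (`0` if the integral has no
continuation to a rational function of `q^s`). -/
noncomputable def sphericalRat (σ : k' ≃ₐ[k] k') [MeasurableSpace (maxCompact σ 3)]
    (μ : Measure (maxCompact σ 3)) (x : Matrix (Fin 3) (Fin 3) k') : RatFunc ℂ :=
  if h : ∃ R : RatFunc ℂ, IsContinuation σ μ x R then h.choose else 0

/-- The spherical function `ω(x; z)`, in the variable `z` related to `s` by
`s = -z - 1 + π√-1 / (2 log q)`. -/
noncomputable def omega (σ : k' ≃ₐ[k] k') [MeasurableSpace (maxCompact σ 3)]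
    (μ : Measure (maxCompact σ 3)) (x : Matrix (Fin 3) (Fin 3) k') (z : ℂ) : ℂ :=
  (sphericalRat σ μ x).eval (RingHom.id ℂ)
    ((residueCard k : ℂ) ^ (-z - 1 + Real.pi * Complex.I / (2 * Real.log (residueCard k))))

end Spherical

end UnitaryHermitian

/-! If `x ∈ X`, then `xj` is an involution of trace 1, so `P = (1 - xj)/2` is an idempotent of trace
1, hence of rank one. Therefore `x = j - (2/c) v v*` with `c = ⟨v, v⟩` for the hermitian form of `j`
(`exists_eq_reflMatrix`). This expression does not change when `v` is scaled, so `v` may be taken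
primitive, and then `|c| = q^(-m)` for some `m ≥ 0`. The action sends `v` to `gv`, so `|d₁(h·x)| =
|2/c| |(hv)₂|²`. The integral thus depends only on the masses `f i` of the sets of `h ∈ K` for which
the last entry of `hv` is divisible by `π^i`.

The masses are computed by double counting, without knowing the orbits of `K` on the sphere `⟨w, w⟩
= c`. Families of lower unipotent elements of `K`, indexed by the residue field of `k` or of `k'`,
move one set of vectors onto another, and left invariance of the measure turns the number of
successful moves into a ratio of masses (`card_mul_orbitMass`). The only arithmetic input is that
the norm of the residue fields takes each nonzero value `q + 1` times. The resulting recurrence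
(`tailRecurrence`) determines `f` from `m`, and lowering `m` by 2 sums the series. With `U =
-q^(-2-2s)` the integral becomes `q^((m-e)s) (q - U) (q² + U - U^m (q² U + 1)) / ((q³ + 1)(1 -
U²))`.

The factor `1 - U` cancels: the quotient is a homogeneous form `symmForm` of degree `m`, symmetric
in `1` and `U`. At `s = -z - 1 + πi/(2 log q)` one has `U = V²` with `V = q^z`, and homogeneity
replaces `1, V²` by `V⁻¹, V`. Symmetry in these gives the functional equation, and `V⁻¹ V = 1` gives
a polynomial in `V + V⁻¹`. For `x_λ` an explicit vector has `m = λ + e` (`exists_sphere_xRep`),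
which yields the explicit formula. -/

namespace UnitaryHermitian

/-! ### Fibres of the norm map of finite fields. -/

section NormCount

/-- The norm is surjective on units of finite fields, so every fibre is a coset of its kernel, of
order `(q² - 1)/(q - 1)`. -/
theorem card_units_norm_fiber {κ L : Type*} [Field κ] [Field L] [Fintype κ] [Algebra κ L]
    [Finite L] (hL : Nat.card L = Fintype.card κ ^ 2) (c : κˣ) :
    Nat.card {u : Lˣ // Units.map (Algebra.norm κ (S := L)) u = c} = Fintype.card κ + 1 := by
  classical
  have := Fintype.ofFinite L
  set f : Lˣ →* κˣ := Units.map (Algebra.norm κ (S := L)) with hf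
  have hsurj : Function.Surjective f := FiniteField.unitsMap_norm_surjective κ L
  obtain ⟨u₀, hu₀⟩ := hsurj c
  have h1 : Nat.card {u : Lˣ // f u = c} = Nat.card f.ker := by
    refine Nat.card_congr ⟨fun u => ⟨u.1 * u₀⁻¹, ?_⟩, fun u => ⟨u.1 * u₀, ?_⟩, ?_, ?_⟩
    · simp [MonoidHom.mem_ker, u.2, hu₀]
    · rw [map_mul, MonoidHom.mem_ker.1 u.2, hu₀, one_mul]
    · intro u; simp
    · intro u; simp
  have h2 := Subgroup.card_eq_card_quotient_mul_card_subgroup f.ker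
  rw [Nat.card_congr (QuotientGroup.quotientKerEquivOfSurjective f hsurj).toEquiv] at h2
  rw [h1]
  rw [Nat.card_units, Nat.card_units, hL, Nat.card_eq_fintype_card] at h2
  have hq : 1 < Fintype.card κ := Fintype.one_lt_card
  obtain ⟨n, hn⟩ : ∃ n, Fintype.card κ = n + 2 := ⟨Fintype.card κ - 2, by omega⟩
  rw [hn] at h2 ⊢
  have h3 : (n + 2) ^ 2 - 1 = (n + 2 - 1) * (n + 2 + 1) := by
    have : (n + 2) ^ 2 = (n + 1) * (n + 3) + 1 := by ring
    rw [this]; rfl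
  rw [h3] at h2
  exact (Nat.eq_of_mul_eq_mul_left (by omega) h2).symm

/-- An anisotropic binary form `a² + ab + db²` over a finite field represents each nonzero element
exactly `|κ| + 1` times. -/
theorem card_binary_form_eq {κ : Type*} [Field κ] [Fintype κ] (d : κ)
    (hd : ∀ t : κ, t ^ 2 - t + d ≠ 0) (c : κ) (hc : c ≠ 0) :
    Nat.card {x : κ × κ // x.1 ^ 2 + x.1 * x.2 + d * x.2 ^ 2 = c} = Fintype.card κ + 1 := by
  -- The form is the norm of `a + bω` with `ω² = ω - d`; having no root makes this quadratic algebra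
  -- a field.
  have : Fact (∀ r : κ, r ^ 2 ≠ -d + 1 * r) := ⟨fun r h => hd r (by rw [h]; ring)⟩
  let L := QuadraticAlgebra κ (-d) 1
  have hfin : Finite L := Finite.of_equiv _ (QuadraticAlgebra.equivProd (-d) (1 : κ)).symm
  have hcard : Nat.card L = Fintype.card κ ^ 2 := by
    rw [Nat.card_congr (QuadraticAlgebra.equivProd (-d) (1 : κ)), Nat.card_prod,
      Nat.card_eq_fintype_card, sq]
  rw [← card_units_norm_fiber hcard (Units.mk0 c hc)]
  have hnorm : ∀ z : L, Algebra.norm κ z = z.re ^ 2 + z.re * z.im + d * z.im ^ 2 := by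
    intro z
    have h1 : Algebra.norm κ z = QuadraticAlgebra.norm z := by
      rw [← QuadraticAlgebra.det_toLinearMap_eq_norm, Algebra.norm_apply]
      rfl
    rw [h1, QuadraticAlgebra.norm_def]
    ring
  refine Nat.card_congr ⟨fun x => ⟨Units.mk0 (⟨x.1.1, x.1.2⟩ : L) ?_, ?_⟩,
    fun u => ⟨(u.1.1.re, u.1.1.im), ?_⟩, ?_, ?_⟩
  · intro h
    have h1 : x.1.1 = 0 := congrArg QuadraticAlgebra.re h
    have h2 : x.1.2 = 0 := congrArg QuadraticAlgebra.im h
    have := x.2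
    rw [h1, h2] at this
    apply hc
    rw [← this]
    ring
  · ext
    simp only [Units.coe_map, Units.val_mk0]
    exact (hnorm _).trans x.2
  · have := congrArg Units.val u.2
    simp only [Units.coe_map, Units.val_mk0] at this
    exact (hnorm _).symm.trans this
  · intro x; rfl
  · intro u; ext <;> rfl

end NormCount

end UnitaryHermitian

namespace UnitaryHermitian

/-! ### Norms and residues in the ring of integers. -/

section Integers

variable {k : Type*} [NontriviallyNormedField k] [IsUltrametricDist k]

theorem mem_integers {x : k} : x ∈ integers k ↔ ‖x‖ ≤ 1 := by
  rw [Valuation.mem_valuationSubring_iff, NormedField.valuation_apply]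
  exact Iff.rfl

theorem norm_integers_le (x : integers k) : ‖(x : k)‖ ≤ 1 := mem_integers.1 x.2

theorem isUnit_integers_iff {x : integers k} : IsUnit x ↔ ‖(x : k)‖ = 1 := by
  constructor
  · rintro ⟨u, rfl⟩
    have h : ‖((u : integers k) : k)‖ * ‖((u⁻¹ : (integers k)ˣ) : integers k).val‖ = 1 := by
      rw [← norm_mul, ← MulMemClass.coe_mul, ← Units.val_mul]
      simp
    refine le_antisymm (norm_integers_le _) ?_
    rw [← h]
    exact mul_le_of_le_one_right (norm_nonneg _) (norm_integers_le _)
  · intro h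
    have h0 : (x : k) ≠ 0 := by rw [← norm_pos_iff, h]; exact one_pos
    refine IsUnit.of_mul_eq_one ⟨(x : k)⁻¹, mem_integers.2 (by rw [norm_inv, h, inv_one])⟩ ?_
    ext
    simp [h0]

theorem residue_eq_iff {x y : integers k} :
    IsLocalRing.residue (integers k) x = IsLocalRing.residue (integers k) y ↔
      ‖(x : k) - y‖ < 1 := by
  rw [← sub_eq_zero, ← map_sub, IsLocalRing.residue_eq_zero_iff, IsLocalRing.mem_maximalIdeal,
    mem_nonunits_iff, isUnit_integers_iff]
  exact ⟨fun h => lt_of_le_of_ne (norm_integers_le (x - y)) h, fun h => ne_of_lt h⟩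

/-- If `|ϖ| < |x| < 1`, then `ϖ = x · (ϖ/x)` would factor `ϖ` into nonunits. Hence the value group
is discrete. -/
theorem norm_le_of_norm_lt_one {ϖ : integers k} (hϖ : Irreducible ϖ) {x : k} (hx : ‖x‖ < 1) :
    ‖x‖ ≤ ‖(ϖ : k)‖ := by
  have hx0 : ¬ IsUnit (⟨x, mem_integers.2 hx.le⟩ : integers k) := by
    rw [isUnit_integers_iff]; exact hx.ne
  rcases le_total ‖x‖ ‖(ϖ : k)‖ with h | h
  · exact h
  by_cases hz : x = 0
  · simp [hz]
  have hxp : 0 < ‖x‖ := norm_pos_iff.2 hz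
  have hdiv : (ϖ : k) / x ∈ integers k := by
    rw [mem_integers, norm_div]
    exact (div_le_one hxp).2 h
  have heq : ϖ = ⟨x, mem_integers.2 hx.le⟩ * ⟨(ϖ : k) / x, hdiv⟩ := by
    ext
    simp [mul_div_cancel₀, hz]
  have := (hϖ.isUnit_or_isUnit heq).resolve_left hx0
  rw [isUnit_integers_iff] at this
  simp only [norm_div] at this
  rw [div_eq_one_iff_eq hxp.ne'] at this
  exact this.ge

theorem exists_norm_eq_pow {ϖ : integers k} (hϖ : Irreducible ϖ) {x : k} (hx0 : x ≠ 0)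
    (hx : ‖x‖ ≤ 1) : ∃ n : ℕ, ‖x‖ = ‖(ϖ : k)‖ ^ n := by
  have hp0 : 0 < ‖(ϖ : k)‖ := norm_pos_iff.2 fun h => hϖ.ne_zero (Subtype.ext h)
  have hp1 : ‖(ϖ : k)‖ < 1 :=
    lt_of_le_of_ne (norm_integers_le ϖ) fun h => hϖ.not_isUnit (isUnit_integers_iff.2 h)
  obtain ⟨n, h1, h2⟩ := exists_nat_pow_near_of_lt_one (norm_pos_iff.2 hx0) hx hp0 hp1
  refine ⟨n, le_antisymm h2 ?_⟩
  by_contra! hlt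
  have h3 : ‖x / (ϖ : k) ^ n‖ < 1 := by
    rw [norm_div, norm_pow]
    exact (div_lt_one (pow_pos hp0 n)).2 hlt
  have h4 := norm_le_of_norm_lt_one hϖ h3
  rw [norm_div, norm_pow, div_le_iff₀ (pow_pos hp0 n), ← pow_succ'] at h4
  exact absurd h4 (not_le.2 h1)

end Integers

/-- Arithmetic of an unramified quadratic extension with prime element `p`, integral basis `1, θ`,
conjugation `σ` and a system `r` of representatives of the residue field `κ` of the fixed field. -/
structure UnramifiedData {k k' : Type*} [NontriviallyNormedField k] [NormedField k']
    [NormedAlgebra k k'] (σ : k' ≃ₐ[k] k') (q : ℕ) (p θ : k') {κ : Type*} [Fintype κ]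
    (r : κ → k') : Prop where
  two_le : 2 ≤ q
  card : Fintype.card κ = q
  conj_conj : ∀ y, σ (σ y) = y
  norm_conj : ∀ y : k', ‖σ y‖ = ‖y‖
  norm_prime : ‖p‖ = (q : ℝ)⁻¹
  conj_prime : σ p = p
  norm_eq_pow : ∀ y : k', y ≠ 0 → ‖y‖ ≤ 1 → ∃ n : ℕ, ‖y‖ = ‖p‖ ^ n
  conj_theta : σ θ = 1 - θ
  norm_theta : ‖θ‖ ≤ 1
  norm_sqrt : ‖2 * θ - 1‖ = 1
  conj_rep : ∀ a, σ (r a) = r a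
  norm_rep : ∀ a, ‖r a‖ ≤ 1
  residue : ∀ y : k', ‖y‖ ≤ 1 → ∃! x : κ × κ, ‖y - (r x.1 + r x.2 * θ)‖ < 1
  card_norm : ∀ c : k', σ c = c → ‖c‖ = 1 → Nat.card {x : κ × κ //
    ‖(r x.1 + r x.2 * θ) * σ (r x.1 + r x.2 * θ) - c‖ < 1} = q + 1

/-! ### Arithmetic of the unramified quadratic extension. -/

section Derivation

theorem norm_algebraMap_eq {k k' : Type*} [NontriviallyNormedField k] [NormedField k']
    [NormedAlgebra k k'] (x : k) : ‖algebraMap k k' x‖ = ‖x‖ := norm_algebraMap' k' x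

variable {k k' : Type*} [NontriviallyNormedField k] [IsUltrametricDist k]
  [NormedField k'] [NormedAlgebra k k']

/-- Representatives of the residue field of `k`, as elements of `k'`. -/
noncomputable def residueRep (k k' : Type*) [NontriviallyNormedField k] [IsUltrametricDist k]
    [NormedField k'] [NormedAlgebra k k'] (a : IsLocalRing.ResidueField (integers k)) : k' :=
  algebraMap k k' (Function.surjInv IsLocalRing.residue_surjective a : integers k)

variable [IsUltrametricDist k']

theorem unramifiedData [Fintype (IsLocalRing.ResidueField (integers k))] [CharZero k]
    (q : ℕ) (hq : q = residueCard k) (ϖ : integers k) (hϖ : Irreducible ϖ)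
    (hnorm : ‖(ϖ : k)‖ = (q : ℝ)⁻¹)
    (hunram : ∀ y : k', ∃ x : k, ‖x‖ = ‖y‖)
    (σ : k' ≃ₐ[k] k') (hσ : σ ≠ AlgEquiv.refl)
    (ε : k) (hε : ‖ε‖ = 1) (rε : k') (hrε : rε ^ 2 = algebraMap k k' ε)
    (hbasis : ∀ y : k', ‖y‖ ≤ 1 ↔ ∃! p : integers k × integers k,
        y = algebraMap k k' p.1 + algebraMap k k' p.2 * ((1 + rε) / 2)) :
    UnramifiedData σ q (algebraMap k k' ϖ) ((1 + rε) / 2) (residueRep k k') := by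
  have hinj : Function.Injective (algebraMap k k') := (algebraMap k k').injective
  have : CharZero k' := charZero_of_injective_algebraMap hinj
  have hint : ∀ y : k', ‖y‖ ≤ 1 → ∃ a b : integers k,
      y = algebraMap k k' a + algebraMap k k' b * ((1 + rε) / 2) := by
    intro y hy
    obtain ⟨p, hp, -⟩ := (hbasis y).1 hy
    exact ⟨p.1, p.2, hp⟩
  have hzero : ∀ a b : integers k, algebraMap k k' a + algebraMap k k' b * ((1 + rε) / 2) = 0 →
      a = 0 ∧ b = 0 := by
    intro a b hab
    have h := (hbasis 0).1 (by simp)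
    have := h.unique (y₁ := (a, b)) (y₂ := (0, 0)) hab.symm (by simp)
    simpa using this
  have hle : ∀ a b : integers k,
      ‖algebraMap k k' a + algebraMap k k' b * ((1 + rε) / 2)‖ ≤ 1 := by
    intro a b
    refine (hbasis _).2 ⟨(a, b), rfl, ?_⟩
    rintro ⟨a', b'⟩ h
    obtain ⟨h1, h2⟩ := hzero (a - a') (b - b') (by
      simp only [AddSubgroupClass.coe_sub, map_sub]
      linear_combination h)
    rw [sub_eq_zero] at h1 h2
    rw [h1, h2]
  -- The extension is unramified, so a scalar from `k` of the same norm reduces any nonzero `y` to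
  -- an integral element.
  have hspan : ∀ y : k', ∃ c : k, ∃ a b : integers k, c ≠ 0 ∧ ‖c‖ = ‖y‖ ∧
      y = algebraMap k k' c *
        (algebraMap k k' a + algebraMap k k' b * ((1 + rε) / 2)) ∨ y = 0 := by
    intro y
    by_cases hy : y = 0
    · exact ⟨0, 0, 0, Or.inr hy⟩
    obtain ⟨c, hc⟩ := hunram y
    have hc0 : c ≠ 0 := by
      rw [← norm_pos_iff, hc]
      exact norm_pos_iff.2 hy
    have hc0' : algebraMap k k' c ≠ 0 := by simpa using hc0
    obtain ⟨a, b, hab⟩ := hint (y / algebraMap k k' c) (by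
      rw [norm_div, norm_algebraMap_eq, hc, div_self (norm_ne_zero_iff.2 hy)])
    refine ⟨c, a, b, Or.inl ⟨hc0, hc, ?_⟩⟩
    rw [← hab, mul_div_cancel₀ _ hc0']
  have hσsq : (σ rε) ^ 2 = rε ^ 2 := by
    rw [← map_pow, hrε]
    exact σ.commutes ε
  have hσr : σ rε = -rε := by
    rcases sq_eq_sq_iff_eq_or_eq_neg.1 hσsq with h | h
    -- An automorphism fixing `rε` would fix every element, by `hspan`.
    · refine absurd (AlgEquiv.ext fun y => ?_) hσ
      obtain ⟨c, a, b, h1 | h1⟩ := hspan y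
      · rw [h1.2.2]
        simp [h, map_ofNat]
      · simp [h1]
    · exact h
  have hσθ : σ ((1 + rε) / 2) = 1 - (1 + rε) / 2 := by
    rw [map_div₀, map_add, hσr]
    simp only [map_one, map_ofNat]
    ring
  have hσint : ∀ a b : integers k,
      σ (algebraMap k k' a + algebraMap k k' b * ((1 + rε) / 2)) =
      algebraMap k k' (a + b : integers k) + algebraMap k k' (-b : integers k) *
        ((1 + rε) / 2) := by
    intro a b
    rw [map_add, map_mul, hσθ, AlgEquiv.commutes, AlgEquiv.commutes]
    simp only [AddMemClass.coe_add, NegMemClass.coe_neg, map_add, map_neg]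
    ring
  have hnle : ∀ y, ‖σ y‖ ≤ ‖y‖ := by
    intro y
    obtain ⟨c, a, b, h1 | h1⟩ := hspan y
    · obtain ⟨hc0, hc, hy⟩ := h1
      rw [← hc, hy, map_mul, AlgEquiv.commutes, norm_mul, norm_algebraMap_eq, hσint]
      exact mul_le_of_le_one_right (norm_nonneg _) (hle _ _)
    · simp [h1]
  have hconj2 : ∀ y, σ (σ y) = y := by
    intro y
    obtain ⟨c, a, b, h1 | h1⟩ := hspan y
    · rw [h1.2.2]
      rw [map_mul, map_mul, AlgEquiv.commutes, AlgEquiv.commutes, hσint, hσint]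
      simp
    · simp [h1]
  -- An integral element of norm less than 1 stays integral after division by `ϖ`; uniqueness of
  -- coordinates then makes both coordinates divisible by `ϖ`.
  have hres : ∀ a b : integers k,
      ‖algebraMap k k' a + algebraMap k k' b * ((1 + rε) / 2)‖ < 1 →
      ‖(a : k)‖ < 1 ∧ ‖(b : k)‖ < 1 := by
    intro a b h
    have hϖ0 : (ϖ : k) ≠ 0 := fun h => hϖ.ne_zero (Subtype.ext h)
    have hϖ1 : ‖(ϖ : k)‖ < 1 :=
      lt_of_le_of_ne (norm_integers_le ϖ) fun h => hϖ.not_isUnit (isUnit_integers_iff.2 h)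
    have hϖ0' : algebraMap k k' ϖ ≠ 0 := by simpa using hϖ0
    obtain ⟨x, hx⟩ := hunram (algebraMap k k' a + algebraMap k k' b * ((1 + rε) / 2))
    have h2 := norm_le_of_norm_lt_one hϖ (x := x) (by rw [hx]; exact h)
    obtain ⟨a', b', hab⟩ := hint ((algebraMap k k' a + algebraMap k k' b * ((1 + rε) / 2)) /
      algebraMap k k' ϖ) (by
        rw [norm_div, norm_algebraMap_eq, ← hx]
        exact (div_le_one (norm_pos_iff.2 hϖ0)).2 h2)
    rw [div_eq_iff hϖ0'] at hab
    obtain ⟨h3, h4⟩ := hzero (a - a' * ϖ) (b - b' * ϖ) (by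
      simp only [AddSubgroupClass.coe_sub, map_sub, MulMemClass.coe_mul, map_mul]
      linear_combination hab)
    rw [sub_eq_zero] at h3 h4
    rw [h3, h4]
    simp only [MulMemClass.coe_mul, norm_mul]
    exact ⟨mul_lt_one_of_nonneg_of_lt_one_right (norm_integers_le _) (norm_nonneg _) hϖ1,
      mul_lt_one_of_nonneg_of_lt_one_right (norm_integers_le _) (norm_nonneg _) hϖ1⟩
  have hres' : ∀ a b : integers k, ‖(a : k)‖ < 1 → ‖(b : k)‖ < 1 →
      ‖algebraMap k k' a + algebraMap k k' b * ((1 + rε) / 2)‖ < 1 := by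
    intro a b ha hb
    refine lt_of_le_of_lt (IsUltrametricDist.norm_add_le_max _ _) (max_lt ?_ ?_)
    · rwa [norm_algebraMap_eq]
    · rw [norm_mul, norm_algebraMap_eq]
      refine mul_lt_one_of_nonneg_of_lt_one_left (norm_nonneg _) hb ?_
      simpa using hle 0 1
  set S : IsLocalRing.ResidueField (integers k) → integers k :=
    Function.surjInv IsLocalRing.residue_surjective with hS
  have hSr : ∀ a, IsLocalRing.residue (integers k) (S a) = a :=
    Function.surjInv_eq IsLocalRing.residue_surjective
  have hcard : Fintype.card (IsLocalRing.ResidueField (integers k)) = q := by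
    rw [hq, residueCard, Nat.card_eq_fintype_card]
  have hfix : ∀ y : k', σ y = y → ‖y‖ ≤ 1 → ∃ a : integers k, y = algebraMap k k' a := by
    intro y hy hy1
    obtain ⟨a, b, rfl⟩ := hint y hy1
    rw [hσint] at hy
    have := (hzero (-b) (b + b) (by
      simp only [AddMemClass.coe_add, NegMemClass.coe_neg, map_add, map_neg] at hy ⊢
      linear_combination -hy)).1
    rw [neg_eq_zero] at this
    exact ⟨a, by simp [this]⟩
  have hθn : ‖(1 + rε) / 2‖ ≤ 1 := by simpa using hle 0 1
  refine ⟨?_, hcard, hconj2, ?_, ?_, ?_, ?_, hσθ, hθn, ?_, ?_, ?_, ?_, ?_⟩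
  · rw [← hcard]
    exact Fintype.one_lt_card
  · intro y
    refine le_antisymm (hnle y) ?_
    conv_lhs => rw [← hconj2 y]
    exact hnle _
  · rw [norm_algebraMap_eq, hnorm]
  · exact σ.commutes _
  · intro y hy hy1
    obtain ⟨x, hx⟩ := hunram y
    rw [← hx, norm_algebraMap_eq]
    refine exists_norm_eq_pow hϖ ?_ (hx.trans_le hy1)
    rw [← norm_pos_iff, hx]
    exact norm_pos_iff.2 hy
  · have h1 : 2 * ((1 + rε) / 2) - 1 = rε := by ring
    rw [h1]
    have h2 : ‖rε‖ ^ 2 = 1 := by rw [← norm_pow, hrε, norm_algebraMap_eq, hε]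
    exact (pow_eq_one_iff_of_nonneg (norm_nonneg _) two_ne_zero).1 h2
  · intro a; exact σ.commutes _
  · intro a
    rw [residueRep, norm_algebraMap_eq]
    exact norm_integers_le _
  · intro y hy
    obtain ⟨a, b, rfl⟩ := hint y hy
    refine ⟨(IsLocalRing.residue _ a, IsLocalRing.residue _ b), ?_, ?_⟩
    · have := hres' (a - S (IsLocalRing.residue _ a)) (b - S (IsLocalRing.residue _ b))
        (residue_eq_iff.1 (hSr _).symm) (residue_eq_iff.1 (hSr _).symm)
      simp only [AddSubgroupClass.coe_sub, map_sub] at this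
      convert this using 2
      simp only [residueRep]
      ring
    · rintro ⟨a', b'⟩ h
      obtain ⟨h1, h2⟩ := hres (a - S a') (b - S b') (by
        simp only [AddSubgroupClass.coe_sub, map_sub]
        convert h using 2
        simp only [residueRep]
        ring)
      rw [AddSubgroupClass.coe_sub, ← residue_eq_iff, hSr] at h1 h2
      rw [h1, h2]
  · intro c hc hc1
    obtain ⟨γ, rfl⟩ := hfix c hc hc1.le
    obtain ⟨δ, hδ⟩ := hfix ((1 + rε) / 2 * σ ((1 + rε) / 2)) (by rw [map_mul, hconj2, mul_comm])
      (by rw [norm_mul, hσθ, ← hσθ]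
          exact mul_le_one₀ hθn (norm_nonneg _) ((hnle _).trans hθn))
    -- With `δ = θ σ(θ)` and `θ + σ(θ) = 1`, the norm of `a + bθ` is `a² + ab + δb²`.
    rw [← hcard, ← card_binary_form_eq (IsLocalRing.residue _ δ) ?_ (IsLocalRing.residue _ γ) ?_]
    · refine Nat.card_congr (Equiv.subtypeEquivRight fun x => ?_)
      rw [← hSr x.1, ← hSr x.2]
      simp only [← map_pow, ← map_mul, ← map_add]
      rw [residue_eq_iff, ← norm_algebraMap_eq (k' := k')]
      simp only [hSr]
      refine iff_of_eq (congrArg (fun y => ‖y‖ < 1) ?_)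
      simp only [residueRep, AddMemClass.coe_add, MulMemClass.coe_mul,
        SubmonoidClass.coe_pow, map_add, map_sub, map_mul, map_pow, ← hδ, AlgEquiv.commutes,
        hσθ]
      ring
    · intro t
      obtain ⟨t, rfl⟩ := IsLocalRing.residue_surjective t
      rw [← map_pow, ← map_sub, ← map_add, Ne, IsLocalRing.residue_eq_zero_iff,
        IsLocalRing.mem_maximalIdeal, mem_nonunits_iff, not_not, isUnit_integers_iff,
        ← norm_algebraMap_eq (k' := k')]
      -- `t² - t + δ = (t - θ)(t - σθ)`. Both factors are units because their coefficient at `θ` is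
      -- `±1`, so the reduced form is anisotropic.
      have h1 : ‖algebraMap k k' t + algebraMap k k' (-1 : integers k) * ((1 + rε) / 2)‖ = 1 := by
        refine le_antisymm (hle _ _) (not_lt.1 fun h => ?_)
        have := (hres _ _ h).2
        simp at this
      have h2 : ‖algebraMap k k' (t + -1 : integers k) +
          algebraMap k k' (- -1 : integers k) * ((1 + rε) / 2)‖ = 1 := by
        refine le_antisymm (hle _ _) (not_lt.1 fun h => ?_)
        have := (hres _ _ h).2
        simp at this
      rw [← hσint] at h2
      rw [← mul_one (1 : ℝ)]
      nth_rewrite 1 [← h1]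
      rw [← h2, ← norm_mul]
      congr 1
      simp only [AddMemClass.coe_add, NegMemClass.coe_neg, OneMemClass.coe_one,
        SubmonoidClass.coe_pow, AddSubgroupClass.coe_sub, map_add, map_sub, map_mul, map_pow,
        map_neg, map_one, ← hδ, AlgEquiv.commutes, hσθ]
      ring
    · rw [Ne, IsLocalRing.residue_eq_zero_iff, IsLocalRing.mem_maximalIdeal, mem_nonunits_iff,
        not_not, isUnit_integers_iff, ← norm_algebraMap_eq (k' := k')]
      exact hc1

end Derivation

end UnitaryHermitian

namespace UnitaryHermitian

theorem antidiag_three (R : Type*) [Zero R] [One R] :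
    antidiag 3 R = !![0, 0, 1; 0, 1, 0; 1, 0, 0] := by
  ext i j
  fin_cases i <;> fin_cases j <;> rfl

/-! ### Primitive vectors of given length, and elements of `K` moving them. -/

section Sphere

variable {k k' : Type*} [NontriviallyNormedField k] [NormedField k'] [NormedAlgebra k k']

/-- The hermitian form with matrix `antidiag 3 k'`. -/
def hermForm (σ : k' ≃ₐ[k] k') (w : Fin 3 → k') : k' :=
  w 0 * σ (w 2) + w 1 * σ (w 1) + w 2 * σ (w 0)

theorem hermForm_eq_dotProduct (σ : k' ≃ₐ[k] k') (w : Fin 3 → k') :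
    hermForm σ w = (fun i => σ (w i)) ⬝ᵥ ((antidiag 3 k').mulVec w) := by
  simp [hermForm, antidiag_three, dotProduct, Matrix.mulVec, Fin.sum_univ_three]
  ring

theorem hermForm_mulVec {σ : k' ≃ₐ[k] k'} {g : GL (Fin 3) k'} (hg : g ∈ unitaryGroup σ 3)
    (w : Fin 3 → k') : hermForm σ (g.val.mulVec w) = hermForm σ w := by
  have hg' : conjTr σ g.val * antidiag 3 k' * g.val = antidiag 3 k' := hg
  have h1 : (fun i => σ (g.val.mulVec w i)) = Matrix.vecMul (fun i => σ (w i)) (conjTr σ g.val) := by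
    ext i
    simp [Matrix.mulVec, Matrix.vecMul, dotProduct, conjTr, mul_comm]
  rw [hermForm_eq_dotProduct, hermForm_eq_dotProduct, h1, ← Matrix.dotProduct_mulVec,
    Matrix.mulVec_mulVec, Matrix.mulVec_mulVec, hg']

/-- The primitive integral vectors on which the hermitian form takes the value `c`. -/
structure IsSphere (σ : k' ≃ₐ[k] k') (c : k') (w : Fin 3 → k') : Prop where
  norm_le : ∀ i, ‖w i‖ ≤ 1
  exists_norm_eq : ∃ i, ‖w i‖ = 1
  form_eq : hermForm σ w = c

variable [IsUltrametricDist k']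

theorem norm_mulVec_le {g : Matrix (Fin 3) (Fin 3) k'} (hg : ∀ i j, ‖g i j‖ ≤ 1) {w : Fin 3 → k'}
    {C : ℝ} (hC : 0 ≤ C) (hw : ∀ i, ‖w i‖ ≤ C) (i : Fin 3) : ‖g.mulVec w i‖ ≤ C := by
  rw [Matrix.mulVec, dotProduct]
  refine IsUltrametricDist.norm_sum_le_of_forall_le_of_nonneg hC fun l _ => ?_
  rw [norm_mul]
  exact (mul_le_of_le_one_left (norm_nonneg _) (hg i l)).trans (hw l)

theorem IsSphere.mulVec {σ : k' ≃ₐ[k] k'} {c : k'} {w : Fin 3 → k'} (hw : IsSphere σ c w)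
    (g : maxCompact σ 3) : IsSphere σ c ((g : GL (Fin 3) k').val.mulVec w) := by
  obtain ⟨g, hg, hg1, hg2⟩ := g
  refine ⟨norm_mulVec_le hg1 zero_le_one hw.norm_le, ?_, (hermForm_mulVec hg w).trans hw.form_eq⟩
  by_contra! hne
  have hlt : ∀ i, ‖g.val.mulVec w i‖ < 1 := fun i =>
    lt_of_le_of_ne (norm_mulVec_le hg1 zero_le_one hw.norm_le i) (hne i)
  obtain ⟨i, hi⟩ := hw.exists_norm_eq
  -- If every entry of `gw` were a nonunit, the integral matrix `g⁻¹` would carry this over to `w`.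
  obtain ⟨l, hl⟩ := Finite.exists_max fun i => ‖g.val.mulVec w i‖
  have h := norm_mulVec_le hg2 (norm_nonneg _) hl i
  rw [Matrix.mulVec_mulVec, ← Units.val_mul, inv_mul_cancel, Units.val_one,
    Matrix.one_mulVec, hi] at h
  exact absurd (hlt l) (not_lt.2 h)

/-- The trace condition on `z` is exactly what makes the lower unipotent matrix unitary; its inverse
has entries of the same kind, so it lies in `K`. -/
theorem exists_lower {σ : k' ≃ₐ[k] k'} (hσ : ∀ y, σ (σ y) = y) (hσn : ∀ y, ‖σ y‖ = ‖y‖)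
    {y z : k'} (hy : ‖y‖ ≤ 1) (hz : ‖z‖ ≤ 1) (hyz : z + σ z = -(y * σ y)) :
    ∃ g : maxCompact σ 3, ∀ w : Fin 3 → k', (g : GL (Fin 3) k').val.mulVec w =
      ![w 0, w 1 + y * w 0, w 2 - σ y * w 1 + z * w 0] := by
  let M : Matrix (Fin 3) (Fin 3) k' := !![1, 0, 0; y, 1, 0; z, -σ y, 1]
  let N : Matrix (Fin 3) (Fin 3) k' := !![1, 0, 0; -y, 1, 0; σ z, σ y, 1]
  have hMN : M * N = 1 := by
    ext i j
    fin_cases i <;> fin_cases j <;> simp [M, N, Matrix.mul_apply, Fin.sum_univ_three]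
    linear_combination hyz
  have hNM : N * M = 1 := by
    ext i j
    fin_cases i <;> fin_cases j <;> simp [M, N, Matrix.mul_apply, Fin.sum_univ_three]
    linear_combination hyz
  refine ⟨⟨⟨M, N, hMN, hNM⟩, ?_, ?_, ?_⟩, ?_⟩
  · change conjTr σ M * antidiag 3 k' * M = antidiag 3 k'
    ext i j
    fin_cases i <;> fin_cases j <;>
      simp [M, conjTr, antidiag_three, Matrix.mul_apply, Fin.sum_univ_three, hσ]
    linear_combination hyz
  · intro i j
    change ‖M i j‖ ≤ 1
    fin_cases i <;> fin_cases j <;> simp [M, hσn, hy, hz]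
  · intro i j
    change ‖N i j‖ ≤ 1
    fin_cases i <;> fin_cases j <;> simp [N, hσn, hy, hz]
  · intro w
    change M.mulVec w = _
    ext i
    fin_cases i <;> simp [M, Matrix.mulVec, dotProduct, Fin.sum_univ_three] <;> ring

theorem exists_swap (σ : k' ≃ₐ[k] k') :
    ∃ g : maxCompact σ 3, ∀ w : Fin 3 → k', (g : GL (Fin 3) k').val.mulVec w =
      ![w 2, w 1, w 0] := by
  let M : Matrix (Fin 3) (Fin 3) k' := !![0, 0, 1; 0, 1, 0; 1, 0, 0]
  have hM : M * M = 1 := by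
    ext i j
    fin_cases i <;> fin_cases j <;> simp [M, Matrix.mul_apply, Fin.sum_univ_three]
  have hle : ∀ i j, ‖M i j‖ ≤ 1 := by
    intro i j
    fin_cases i <;> fin_cases j <;> simp [M]
  refine ⟨⟨⟨M, M, hM, hM⟩, ?_, hle, hle⟩, ?_⟩
  · change conjTr σ M * antidiag 3 k' * M = antidiag 3 k'
    ext i j
    fin_cases i <;> fin_cases j <;>
      simp [M, conjTr, antidiag_three, Matrix.mul_apply, Fin.sum_univ_three]
  · intro w
    change M.mulVec w = _
    ext i
    fin_cases i <;> simp [M, Matrix.mulVec, dotProduct, Fin.sum_univ_three]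

theorem continuous_orbit {σ : k' ≃ₐ[k] k'} (v : Fin 3 → k') :
    Continuous fun h : maxCompact σ 3 => (h : GL (Fin 3) k').val.mulVec v :=
  (Units.continuous_val.comp continuous_subtype_val).matrix_mulVec continuous_const

end Sphere

/-! ### Masses of sets of vectors along a `K`-orbit. -/

section OrbitMass

variable {k k' : Type*} [NontriviallyNormedField k] [NormedField k'] [NormedAlgebra k k']
  [IsUltrametricDist k'] {σ : k' ≃ₐ[k] k'} [MeasurableSpace (maxCompact σ 3)]

/-- The proportion of the `h` in the maximal compact subgroup that move `v` into `A`. -/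
noncomputable def orbitMass (μ : Measure (maxCompact σ 3)) (v : Fin 3 → k')
    (A : Set (Fin 3 → k')) : ℝ :=
  μ.real {h | (h : GL (Fin 3) k').val.mulVec v ∈ A}

theorem orbitMass_congr (μ : Measure (maxCompact σ 3)) {c : k'} {v : Fin 3 → k'}
    (hv : IsSphere σ c v) {A B : Set (Fin 3 → k')}
    (h : ∀ w, IsSphere σ c w → (w ∈ A ↔ w ∈ B)) : orbitMass μ v A = orbitMass μ v B := by
  rw [orbitMass, orbitMass]
  congr 1
  ext g
  exact h _ (hv.mulVec g)

variable [BorelSpace (maxCompact σ 3)] (μ : Measure (maxCompact σ 3))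

theorem measurableSet_orbit (v : Fin 3 → k') {A : Set (Fin 3 → k')} (hA : IsClosed A) :
    MeasurableSet {h : maxCompact σ 3 | (h : GL (Fin 3) k').val.mulVec v ∈ A} :=
  (hA.preimage (continuous_orbit v)).measurableSet

theorem orbitMass_preimage [μ.IsMulLeftInvariant] (v : Fin 3 → k') (A : Set (Fin 3 → k'))
    (g : maxCompact σ 3) :
    orbitMass μ v {w | (g : GL (Fin 3) k').val.mulVec w ∈ A} = orbitMass μ v A := by
  rw [orbitMass, orbitMass, Measure.real, Measure.real,
    ← measure_preimage_mul μ g {h | (h : GL (Fin 3) k').val.mulVec v ∈ A}]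
  congr 2
  ext h
  simp [Matrix.mulVec_mulVec]

/-- Double counting: if `n` members of a finite family of elements of the group move a given vector
of `A` into `B`, and none moves a vector outside `A` into `B`, then the masses of `A` and `B` are
related by the size of the family. -/
theorem card_mul_orbitMass [μ.IsMulLeftInvariant] [IsProbabilityMeasure μ] {c : k'}
    {v : Fin 3 → k'} (hv : IsSphere σ c v) {A B : Set (Fin 3 → k')} (hA : IsClosed A)
    (hB : IsClosed B) {ι : Type*} [Fintype ι] (T : ι → (Fin 3 → k') → Fin 3 → k')
    (hT : ∀ i, ∃ g : maxCompact σ 3, ∀ w, (g : GL (Fin 3) k').val.mulVec w = T i w) (n : ℕ)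
    (h1 : ∀ w, IsSphere σ c w → w ∈ A → Nat.card {i // T i w ∈ B} = n)
    (h2 : ∀ w, IsSphere σ c w → ∀ i, IsSphere σ c (T i w) → T i w ∈ B → w ∈ A) :
    Fintype.card ι * orbitMass μ v B = n * orbitMass μ v A := by
  classical
  choose g hg using hT
  let s : ι → Set (maxCompact σ 3) := fun i => {h | T i ((h : GL (Fin 3) k').val.mulVec v) ∈ B}
  have hs : ∀ i, s i = (fun h => g i * h) ⁻¹' {h | (h : GL (Fin 3) k').val.mulVec v ∈ B} := by
    intro i
    ext h
    simp [s, ← hg, Matrix.mulVec_mulVec]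
  have hsm : ∀ i, MeasurableSet (s i) := by
    intro i
    rw [hs]
    exact (measurableSet_orbit (σ := σ) v hB).preimage (measurable_const_mul (g i))
  have hsμ : ∀ i, μ.real (s i) = orbitMass μ v B := by
    intro i
    rw [hs, Measure.real, measure_preimage_mul]
    rfl
  have hA' := measurableSet_orbit (σ := σ) v hA
  -- At each `h` the number of `i` with `T i (hv) ∈ B` is `n` or `0` according as `hv ∈ A` or not;
  -- integrating this identity gives the claim.
  have hpt : ∀ h : maxCompact σ 3, ∑ i, (s i).indicator (fun _ => (1 : ℝ)) h =
      {h : maxCompact σ 3 | (h : GL (Fin 3) k').val.mulVec v ∈ A}.indicator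
        (fun _ => (n : ℝ)) h := by
    intro h
    have hw := hv.mulVec h
    by_cases hwA : (h : GL (Fin 3) k').val.mulVec v ∈ A
    · rw [Set.indicator_of_mem
        (s := {h : maxCompact σ 3 | (h : GL (Fin 3) k').val.mulVec v ∈ A}) hwA, ← h1 _ hw hwA, Nat.card_eq_fintype_card,
        Fintype.card_subtype, ← Finset.sum_boole]
      refine Finset.sum_congr rfl fun i _ => ?_
      simp only [Set.indicator_apply, s, Set.mem_ofPred_eq]
    · rw [Set.indicator_of_notMem
        (s := {h : maxCompact σ 3 | (h : GL (Fin 3) k').val.mulVec v ∈ A}) hwA]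
      refine Finset.sum_eq_zero fun i _ => Set.indicator_of_notMem (fun hi => hwA ?_) _
      refine h2 _ hw i ?_ hi
      rw [← hg]
      exact hw.mulVec (g i)
  have hint := integral_congr_ae (μ := μ) (Filter.Eventually.of_forall hpt)
  rw [integral_finsetSum _ fun i _ => (integrable_const _).indicator (hsm i),
    integral_indicator_const _ hA'] at hint
  simp only [integral_indicator_const _ (hsm _), hsμ, smul_eq_mul, mul_one, Finset.sum_const,
    Finset.card_univ, nsmul_eq_mul] at hint
  rw [hint, mul_comm]
  rfl

end OrbitMass

end UnitaryHermitian

namespace UnitaryHermitian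

/-! ### Ultrametric estimates and congruences over the residue fields. -/

theorem norm_add_le_of_le {F : Type*} [NormedField F] [IsUltrametricDist F] {x y : F} {C : ℝ}
    (hx : ‖x‖ ≤ C) (hy : ‖y‖ ≤ C) : ‖x + y‖ ≤ C :=
  (IsUltrametricDist.norm_add_le_max x y).trans (max_le hx hy)

theorem norm_sub_le_of_le {F : Type*} [NormedField F] [IsUltrametricDist F] {x y : F} {C : ℝ}
    (hx : ‖x‖ ≤ C) (hy : ‖y‖ ≤ C) : ‖x - y‖ ≤ C := by
  rw [sub_eq_add_neg]
  exact norm_add_le_of_le hx (by rwa [norm_neg])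

theorem norm_add_lt_of_lt {F : Type*} [NormedField F] [IsUltrametricDist F] {x y : F} {C : ℝ}
    (hx : ‖x‖ < C) (hy : ‖y‖ < C) : ‖x + y‖ < C :=
  (IsUltrametricDist.norm_add_le_max x y).trans_lt (max_lt hx hy)

theorem norm_sub_lt_of_lt {F : Type*} [NormedField F] [IsUltrametricDist F] {x y : F} {C : ℝ}
    (hx : ‖x‖ < C) (hy : ‖y‖ < C) : ‖x - y‖ < C := by
  rw [sub_eq_add_neg]
  exact norm_add_lt_of_lt hx (by rwa [norm_neg])

theorem norm_add_eq_of_lt {F : Type*} [NormedField F] [IsUltrametricDist F] {x y : F}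
    (h : ‖y‖ < ‖x‖) : ‖x + y‖ = ‖x‖ := by
  rw [IsUltrametricDist.norm_add_eq_max_of_norm_ne_norm h.ne', max_eq_left h.le]

theorem card_subtype_eq_one {α : Type*} {P : α → Prop} (h : ∃! x, P x) :
    Nat.card {x // P x} = 1 := by
  obtain ⟨x, hx, hu⟩ := h
  rw [Nat.card_eq_one_iff_exists]
  exact ⟨⟨x, hx⟩, fun y => Subtype.ext (hu y.1 y.2)⟩

/-- Representatives of the residue field of the quadratic extension. -/
def pairRep {F κ : Type*} [Field F] (θ : F) (r : κ → F) (x : κ × κ) : F := r x.1 + r x.2 * θ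

namespace UnramifiedData

variable {k k' : Type*} [NontriviallyNormedField k] [NormedField k'] [NormedAlgebra k k']
  {σ : k' ≃ₐ[k] k'} {q : ℕ} {p θ : k'} {κ : Type*} [Fintype κ] {r : κ → k'}

theorem prime_pos (D : UnramifiedData σ q p θ r) : 0 < ‖p‖ := by
  rw [D.norm_prime, inv_pos]
  exact_mod_cast lt_of_lt_of_le two_pos D.two_le

theorem prime_lt_one (D : UnramifiedData σ q p θ r) : ‖p‖ < 1 := by
  rw [D.norm_prime]
  exact inv_lt_one_of_one_lt₀ (by exact_mod_cast lt_of_lt_of_le one_lt_two D.two_le)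

theorem prime_ne_zero (D : UnramifiedData σ q p θ r) : p ≠ 0 := norm_pos_iff.1 D.prime_pos

theorem pow_le (D : UnramifiedData σ q p θ r) {i j : ℕ} (h : i ≤ j) : ‖p‖ ^ j ≤ ‖p‖ ^ i :=
  pow_le_pow_of_le_one D.prime_pos.le D.prime_lt_one.le h

theorem pow_lt (D : UnramifiedData σ q p θ r) {i j : ℕ} (h : i < j) : ‖p‖ ^ j < ‖p‖ ^ i :=
  pow_lt_pow_right_of_lt_one₀ D.prime_pos D.prime_lt_one h

theorem pow_le_one (D : UnramifiedData σ q p θ r) (i : ℕ) : ‖p‖ ^ i ≤ 1 :=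
  pow_le_one₀ D.prime_pos.le D.prime_lt_one.le

theorem pow_le_pow_iff (D : UnramifiedData σ q p θ r) {i j : ℕ} :
    ‖p‖ ^ j ≤ ‖p‖ ^ i ↔ i ≤ j :=
  ⟨fun h => not_lt.1 fun hlt => absurd (D.pow_lt hlt) (not_lt.2 h), D.pow_le⟩

theorem norm_lt_pow_iff (D : UnramifiedData σ q p θ r) {y : k'} {i : ℕ} :
    ‖y‖ < ‖p‖ ^ i ↔ ‖y‖ ≤ ‖p‖ ^ (i + 1) := by
  refine ⟨fun h => ?_, fun h => h.trans_lt (D.pow_lt i.lt_succ_self)⟩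
  by_cases hy : y = 0
  · rw [hy, norm_zero]
    exact pow_nonneg D.prime_pos.le _
  obtain ⟨n, hn⟩ := D.norm_eq_pow y hy (h.le.trans (D.pow_le_one i))
  rw [hn] at h ⊢
  refine D.pow_le (Nat.succ_le_of_lt (not_le.1 fun hle => absurd (D.pow_le hle) (not_le.2 h)))

theorem norm_lt_one_iff (D : UnramifiedData σ q p θ r) {y : k'} : ‖y‖ < 1 ↔ ‖y‖ ≤ ‖p‖ := by
  simpa using D.norm_lt_pow_iff (y := y) (i := 0)

theorem norm_mul_conj (D : UnramifiedData σ q p θ r) (y : k') : ‖y * σ y‖ = ‖y‖ ^ 2 := by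
  rw [norm_mul, D.norm_conj, sq]

/-- Valuations are integers, so halving an odd exponent `i` may be rounded up; this is the source of
`i + 1`. -/
theorem norm_le_pow_of_sq_le (D : UnramifiedData σ q p θ r) {y : k'} {i j : ℕ}
    (h : ‖y‖ ^ 2 ≤ ‖p‖ ^ i) (hj : 2 * j ≤ i + 1) : ‖y‖ ≤ ‖p‖ ^ j := by
  by_cases hy : y = 0
  · rw [hy, norm_zero]
    exact pow_nonneg D.prime_pos.le _
  have h1 : ‖y‖ ≤ 1 := (sq_le_one_iff₀ (norm_nonneg y)).1 (h.trans (D.pow_le_one i))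
  obtain ⟨n, hn⟩ := D.norm_eq_pow y hy h1
  rw [hn, ← pow_mul, D.pow_le_pow_iff] at h
  rw [hn]
  exact D.pow_le (by omega)

theorem continuous_conj (D : UnramifiedData σ q p θ r) : Continuous σ :=
  (AddMonoidHomClass.isometry_of_norm σ D.norm_conj).continuous

theorem existsUnique_pairRep (D : UnramifiedData σ q p θ r) {a b : k'} (ha : a ≠ 0)
    (hb : ‖b‖ ≤ ‖a‖) : ∃! x : κ × κ, ‖b + a * pairRep θ r x‖ < ‖a‖ := by
  have ha' := norm_pos_iff.2 ha
  have hiff : ∀ x : κ × κ, ‖b + a * pairRep θ r x‖ < ‖a‖ ↔ ‖-(b / a) - pairRep θ r x‖ < 1 := by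
    intro x
    have : b + a * pairRep θ r x = -(a * (-(b / a) - pairRep θ r x)) := by field_simp; ring
    rw [this, norm_neg, norm_mul]
    exact mul_lt_iff_lt_one_right ha'
  simp only [hiff]
  exact D.residue _ (by rw [norm_neg, norm_div]; exact div_le_one_of_le₀ hb ha'.le)

variable [IsUltrametricDist k']

theorem norm_pairRep_le (D : UnramifiedData σ q p θ r) (x : κ × κ) : ‖pairRep θ r x‖ ≤ 1 := by
  refine norm_add_le_of_le (D.norm_rep _) ?_
  rw [norm_mul]
  exact mul_le_one₀ (D.norm_rep _) (norm_nonneg _) D.norm_theta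

/-- If `t ≡ a + bθ`, then `t - σ(t) ≡ b(2θ - 1)`. Since `2θ - 1` is a unit even in residue
characteristic 2, invariance of `t` forces `b ≡ 0`. -/
theorem existsUnique_rep (D : UnramifiedData σ q p θ r) {t : k'} (ht : ‖t‖ ≤ 1)
    (ht' : ‖t - σ t‖ < 1) : ∃! x : κ, ‖t - r x‖ < 1 := by
  obtain ⟨⟨a, b⟩, hab, hu⟩ := D.residue t ht
  dsimp only at hab hu
  have hb : ‖r b‖ < 1 := by
    have h1 : ‖σ (t - (r a + r b * θ))‖ < 1 := by rwa [D.norm_conj]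
    rw [map_sub, map_add, map_mul, D.conj_rep, D.conj_rep, D.conj_theta] at h1
    have h2 := norm_sub_lt_of_lt ht' (norm_sub_lt_of_lt hab h1)
    have h3 : t - σ t - (t - (r a + r b * θ) - (σ t - (r a + r b * (1 - θ)))) =
        r b * (2 * θ - 1) := by ring
    rwa [h3, norm_mul, D.norm_sqrt, mul_one] at h2
  have hb' : ‖r b * θ‖ < 1 := by
    rw [norm_mul]
    exact mul_lt_one_of_nonneg_of_lt_one_left (norm_nonneg _) hb D.norm_theta
  refine ⟨a, ?_, ?_⟩
  · have := norm_add_lt_of_lt hab hb'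
    have h3 : t - (r a + r b * θ) + r b * θ = t - r a := by ring
    rwa [h3] at this
  · intro a' ha'
    have := norm_sub_lt_of_lt ha' hb'
    have h3 : t - r a' - r b * θ = t - (r a' + r b * θ) := by ring
    rw [h3] at this
    exact congrArg Prod.fst (hu (a', b) this)

/-- The last hypothesis says that `b/a` is fixed by `σ` modulo the maximal ideal, so the congruence
is solvable in the smaller residue field. -/
theorem card_rep (D : UnramifiedData σ q p θ r) {a b : k'} (ha : a ≠ 0)
    (hb : ‖b‖ ≤ ‖a‖) (hab : ‖b * σ a - σ b * a‖ < ‖a‖ ^ 2) :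
    Nat.card {x : κ // ‖b + a * r x‖ < ‖a‖} = 1 := by
  have ha' := norm_pos_iff.2 ha
  have hσa : σ a ≠ 0 := by simpa using ha
  have hiff : ∀ x : κ, ‖b + a * r x‖ < ‖a‖ ↔ ‖-(b / a) - r x‖ < 1 := by
    intro x
    have : b + a * r x = -(a * (-(b / a) - r x)) := by field_simp; ring
    rw [this, norm_neg, norm_mul]
    exact mul_lt_iff_lt_one_right ha'
  simp only [hiff]
  refine card_subtype_eq_one (D.existsUnique_rep ?_ ?_)
  · rw [norm_neg, norm_div]
    exact div_le_one_of_le₀ hb ha'.le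
  · have : -(b / a) - σ (-(b / a)) = -((b * σ a - σ b * a) / (a * σ a)) := by
      rw [map_neg, map_div₀]
      field_simp
      ring
    rw [this, norm_neg, norm_div, D.norm_mul_conj]
    exact (div_lt_one (pow_pos ha' 2)).2 hab

theorem norm_mul_conj_sub_lt (D : UnramifiedData σ q p θ r) {y y' : k'} (hy : ‖y‖ ≤ 1)
    (hy' : ‖y'‖ ≤ 1) (h : ‖y - y'‖ < 1) : ‖y * σ y - y' * σ y'‖ < 1 := by
  have : y * σ y - y' * σ y' = y * σ (y - y') + (y - y') * σ y' := by
    rw [map_sub]; ring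
  rw [this]
  refine norm_add_lt_of_lt ?_ ?_
  · rw [norm_mul, D.norm_conj]
    exact mul_lt_one_of_nonneg_of_lt_one_right hy (norm_nonneg _) h
  · rw [norm_mul, D.norm_conj]
    exact mul_lt_one_of_nonneg_of_lt_one_left (norm_nonneg _) h hy'

/-- The norm form on a translate of the residue field takes each unit value `q + 1` times. -/
theorem card_affine_norm (D : UnramifiedData σ q p θ r) {u w c : k'} (hu : ‖u‖ ≤ 1)
    (hw : ‖w‖ = 1) (hσc : σ c = c) (hc : ‖c‖ = 1) :
    Nat.card {x : κ × κ //
      ‖c - (u + pairRep θ r x * w) * σ (u + pairRep θ r x * w)‖ < 1} = q + 1 := by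
  have hw0 : w ≠ 0 := norm_pos_iff.1 (hw ▸ one_pos)
  have hle : ∀ x : κ × κ, ‖u + pairRep θ r x * w‖ ≤ 1 := fun x =>
    norm_add_le_of_le hu (by rw [norm_mul, hw, mul_one]; exact D.norm_pairRep_le x)
  choose f hf hfu using fun x => D.residue _ (hle x)
  -- As `w` is a unit, `x ↦ u + xw` permutes the residue field, which reduces the count to `u = 0`,
  -- `w = 1`.
  have hinj : Function.Injective f := by
    intro x x' hxx
    have h1 := norm_sub_lt_of_lt (hf x) (hxx ▸ hf x')
    have h2 : ∀ y, u + pairRep θ r x * w - y - (u + pairRep θ r x' * w - y) =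
        w * (pairRep θ r x - pairRep θ r x') := by intro y; ring
    rw [h2, norm_mul, hw, one_mul] at h1
    exact (D.residue _ (D.norm_pairRep_le x)).unique
      (by simp [pairRep]) h1
  have hbij : Function.Bijective f := Finite.injective_iff_bijective.1 hinj
  rw [← D.card_norm c hσc hc]
  refine Nat.card_congr (Equiv.subtypeEquiv (Equiv.ofBijective f hbij) fun x => ?_)
  have h1 := D.norm_mul_conj_sub_lt (hle x) (D.norm_pairRep_le (f x)) (hf x)
  constructor
  · intro h
    have h2 := norm_add_lt_of_lt h h1
    rw [sub_add_sub_cancel, norm_sub_rev] at h2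
    exact h2
  · intro h
    have h2 := norm_add_lt_of_lt h1 h
    rw [Equiv.ofBijective_apply] at h2
    change ‖_ - pairRep θ r (f x) * σ (pairRep θ r (f x)) +
      (pairRep θ r (f x) * σ (pairRep θ r (f x)) - c)‖ < 1 at h2
    rw [sub_add_sub_cancel, norm_sub_rev] at h2
    exact h2

end UnramifiedData

end UnitaryHermitian

namespace UnitaryHermitian

/-! ### Counting relations between sets of vectors with divisible last entry. -/

variable {k k' : Type*} [NontriviallyNormedField k] [NormedField k'] [NormedAlgebra k k']

/-- Vectors whose last entry is divisible by `p ^ i`. -/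
def tailSet (p : k') (i : ℕ) : Set (Fin 3 → k') := {w | ‖w 2‖ ≤ ‖p‖ ^ i}

/-- Vectors whose first entry is a unit and whose last entry is divisible by `p ^ i`. -/
def unitTailSet (p : k') (i : ℕ) : Set (Fin 3 → k') := {w | ‖w 0‖ = 1 ∧ ‖w 2‖ ≤ ‖p‖ ^ i}

/-- Vectors in `unitTailSet p i` whose middle entry has norm congruent to `c` mod `p ^ (i + 1)`. -/
def normTailSet (σ : k' ≃ₐ[k] k') (c p : k') (i : ℕ) : Set (Fin 3 → k') :=
  {w | ‖w 0‖ = 1 ∧ ‖w 2‖ ≤ ‖p‖ ^ i ∧ ‖c - w 1 * σ (w 1)‖ ≤ ‖p‖ ^ (i + 1)}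

theorem isClosed_tailSet (p : k') (i : ℕ) : IsClosed (tailSet p i) :=
  isClosed_le (by fun_prop) continuous_const

theorem isClosed_unitTailSet (p : k') (i : ℕ) : IsClosed (unitTailSet p i) :=
  (isClosed_eq (by fun_prop) continuous_const).inter (isClosed_tailSet p i)

theorem isClosed_normTailSet {σ : k' ≃ₐ[k] k'} (hσ : Continuous σ) (c p : k') (i : ℕ) :
    IsClosed (normTailSet σ c p i) :=
  (isClosed_eq (by fun_prop) continuous_const).inter
    ((isClosed_tailSet p i).inter (isClosed_le (continuous_const.sub ((continuous_apply 1).mul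
      (hσ.comp (continuous_apply 1)))).norm continuous_const))

variable {σ : k' ≃ₐ[k] k'} {c : k'}

theorem IsSphere.sub_eq {w : Fin 3 → k'} (hw : IsSphere σ c w) :
    c - w 1 * σ (w 1) = w 0 * σ (w 2) + w 2 * σ (w 0) := by
  rw [← hw.form_eq, hermForm]; ring

variable {q : ℕ} {p θ : k'} {κ : Type*} [Fintype κ] {r : κ → k'}

theorem IsSphere.conj_eq (D : UnramifiedData σ q p θ r) {w : Fin 3 → k'} (hw : IsSphere σ c w) :
    σ c = c := by
  rw [← hw.form_eq, hermForm]
  simp only [map_add, map_mul, D.conj_conj]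
  ring

theorem norm_lowerMap_sub_le (D : UnramifiedData σ q p θ r) {y : k'} {w : Fin 3 → k'}
    (hw : ‖w 0‖ ≤ 1) {C : ℝ} (hy : ‖y‖ ^ 2 ≤ C) : ‖(0 * (2 * θ - 1) - y * σ y * θ) * w 0‖ ≤ C := by
  rw [zero_mul, zero_sub, neg_mul, norm_neg, norm_mul, norm_mul, D.norm_mul_conj]
  exact (mul_le_of_le_one_right (by positivity) hw).trans
    ((mul_le_of_le_one_right (by positivity) D.norm_theta).trans hy)

variable [IsUltrametricDist k']

theorem IsSphere.norm_sub_le (D : UnramifiedData σ q p θ r) {w : Fin 3 → k'}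
    (hw : IsSphere σ c w) {C : ℝ} (h : ‖w 0‖ ≤ C ∨ ‖w 2‖ ≤ C) : ‖c - w 1 * σ (w 1)‖ ≤ C := by
  rw [hw.sub_eq]
  have h0 := hw.norm_le 0
  have h2 := hw.norm_le 2
  have : ‖w 0‖ * ‖w 2‖ ≤ C := by
    rcases h with h | h
    · exact (mul_le_of_le_one_right (norm_nonneg _) h2).trans h
    · exact (mul_le_of_le_one_left (norm_nonneg _) h0).trans h
  refine norm_add_le_of_le ?_ ?_
  · rwa [norm_mul, D.norm_conj]
  · rwa [norm_mul, D.norm_conj, mul_comm]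

theorem IsSphere.norm_one_sq_le (D : UnramifiedData σ q p θ r) {w : Fin 3 → k'}
    {C : ℝ} (hc : ‖c‖ ≤ C) (h : ‖c - w 1 * σ (w 1)‖ ≤ C) : ‖w 1‖ ^ 2 ≤ C := by
  rw [← D.norm_mul_conj]
  have := norm_sub_le_of_le hc h
  rwa [sub_sub_cancel] at this

theorem IsSphere.norm_one_sq_eq (D : UnramifiedData σ q p θ r) {w : Fin 3 → k'}
    (h : ‖c - w 1 * σ (w 1)‖ < ‖c‖) : ‖w 1‖ ^ 2 = ‖c‖ := by
  rw [← D.norm_mul_conj, ← norm_add_eq_of_lt (x := c) (y := -(c - w 1 * σ (w 1))) (by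
    rwa [norm_neg])]
  congr 1
  ring

/-- The lower triangular unipotent transformation attached to `y` and `s`. -/
def lowerMap (σ : k' ≃ₐ[k] k') (θ y s : k') (w : Fin 3 → k') : Fin 3 → k' :=
  ![w 0, w 1 + y * w 0, w 2 - σ y * w 1 + (s * (2 * θ - 1) - y * σ y * θ) * w 0]

/-- `2θ - 1` has trace 0 and `θ` has trace 1, so `s(2θ - 1) - yσ(y)θ` has trace `-yσ(y)`. Using `θ`
in place of `1/2` keeps the entries integral in residue characteristic 2. -/
theorem exists_lowerMap (D : UnramifiedData σ q p θ r) {y s : k'} (hy : ‖y‖ ≤ 1) (hs : ‖s‖ ≤ 1)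
    (hσs : σ s = s) : ∃ g : maxCompact σ 3, ∀ w : Fin 3 → k',
      (g : GL (Fin 3) k').val.mulVec w = lowerMap σ θ y s w := by
  refine exists_lower D.conj_conj D.norm_conj hy (norm_sub_le_of_le ?_ ?_) ?_
  · rwa [norm_mul, D.norm_sqrt, mul_one]
  · rw [norm_mul, D.norm_mul_conj]
    exact mul_le_one₀ (pow_le_one₀ (norm_nonneg _) hy) (norm_nonneg _) D.norm_theta
  · simp only [map_sub, map_mul, hσs, map_ofNat, map_one, D.conj_theta, D.conj_conj]
    ring

variable [MeasurableSpace (maxCompact σ 3)] [BorelSpace (maxCompact σ 3)]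
  (μ : Measure (maxCompact σ 3)) [μ.IsMulLeftInvariant] [IsProbabilityMeasure μ]
  {v : Fin 3 → k'}

/-- The `q` moves with `y = 0` add multiples of `(2θ - 1) p^i w₀` to `w₂`. The condition on `c -
w₁σ(w₁)`, which is the trace of `w₀σ(w₂)`, says that the required multiplier is fixed by `σ` modulo
`p`, so exactly one move succeeds. -/
theorem orbitMass_normTailSet (D : UnramifiedData σ q p θ r) (hv : IsSphere σ c v) (i : ℕ) :
    q * orbitMass μ v (unitTailSet p (i + 1)) = orbitMass μ v (normTailSet σ c p i) := by
  suffices h : Fintype.card κ * orbitMass μ v (unitTailSet p (i + 1)) =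
      (1 : ℕ) * orbitMass μ v (normTailSet σ c p i) by
    rwa [D.card, Nat.cast_one, one_mul] at h
  have hp := D.prime_ne_zero
  have hs : ∀ a, ‖r a * p ^ i‖ ≤ ‖p‖ ^ i := fun a => by
    rw [norm_mul, norm_pow]
    exact mul_le_of_le_one_left (by positivity) (D.norm_rep a)
  refine card_mul_orbitMass μ hv (isClosed_normTailSet D.continuous_conj _ _ _)
    (isClosed_unitTailSet _ _) (fun a => lowerMap σ θ 0 (r a * p ^ i)) ?_ 1 ?_ ?_
  · intro a
    exact exists_lowerMap D (by simp) ((hs a).trans (D.pow_le_one i))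
      (by rw [map_mul, map_pow, D.conj_rep, D.conj_prime])
  · rintro w hw ⟨h0, h2, hc⟩
    have hw0 : w 0 ≠ 0 := norm_pos_iff.1 (h0 ▸ one_pos)
    have hθ0 : 2 * θ - 1 ≠ 0 := norm_pos_iff.1 (D.norm_sqrt ▸ one_pos)
    have hna : ‖(2 * θ - 1) * p ^ i * w 0‖ = ‖p‖ ^ i := by
      rw [norm_mul, norm_mul, D.norm_sqrt, h0, norm_pow, one_mul, mul_one]
    refine Eq.trans ?_ (D.card_rep (a := (2 * θ - 1) * p ^ i * w 0) (b := w 2)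
      (by simp [hw0, hθ0, hp]) (by rwa [hna]) ?_)
    · refine Nat.card_congr (Equiv.subtypeEquivRight fun a => ?_)
      rw [hna, D.norm_lt_pow_iff]
      have : (lowerMap σ θ 0 (r a * p ^ i) w) 2 = w 2 + (2 * θ - 1) * p ^ i * w 0 * r a := by
        simp [lowerMap]
        ring
      rw [← this]
      exact and_iff_right h0
    · have : w 2 * σ ((2 * θ - 1) * p ^ i * w 0) - σ (w 2) * ((2 * θ - 1) * p ^ i * w 0) =
          -((2 * θ - 1) * p ^ i * (c - w 1 * σ (w 1))) := by
        rw [hw.sub_eq]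
        simp only [map_sub, map_mul, map_pow, map_ofNat, map_one, D.conj_theta, D.conj_prime]
        ring
      rw [this, hna, norm_neg, norm_mul, norm_mul, D.norm_sqrt, one_mul, norm_pow, sq]
      have h3 : ‖c - w 1 * σ (w 1)‖ < ‖p‖ ^ i := D.norm_lt_pow_iff.2 hc
      exact mul_lt_mul_of_pos_left h3 (pow_pos D.prime_pos i)
  · rintro w hw a hTw ⟨h0, h2⟩
    have h0' : ‖w 0‖ = 1 := h0
    refine ⟨h0', ?_, ?_⟩
    · have h3 : w 2 = (lowerMap σ θ 0 (r a * p ^ i) w) 2 - (2 * θ - 1) * (r a * p ^ i) * w 0 := by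
        simp [lowerMap]
        ring
      rw [h3]
      refine norm_sub_le_of_le (h2.trans (D.pow_le i.le_succ)) ?_
      rw [norm_mul, norm_mul, h0', mul_one, D.norm_sqrt, one_mul]
      exact hs a
    · have h3 := hTw.norm_sub_le D (Or.inr h2)
      simpa [lowerMap] using h3

/-- The masses of `normTailSet` and `unitTailSet` compare by the number `n` of residues at which the
norm form takes a prescribed value. -/
theorem orbitMass_normTailSet_even (D : UnramifiedData σ q p θ r) (hv : IsSphere σ c v) {j : ℕ}
    (hc : ‖c‖ ≤ ‖p‖ ^ (2 * j)) (n : ℕ)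
    (hn : ∀ u w : k', ‖u‖ ≤ 1 → ‖w‖ = 1 → Nat.card {x : κ × κ // ‖c / p ^ (2 * j) -
      (u + pairRep θ r x * w) * σ (u + pairRep θ r x * w)‖ < 1} = n) :
    (q : ℝ) ^ 2 * orbitMass μ v (normTailSet σ c p (2 * j)) =
      n * orbitMass μ v (unitTailSet p (2 * j)) := by
  have hp := D.prime_ne_zero
  have hcard : (q : ℝ) ^ 2 = (Fintype.card (κ × κ) : ℕ) := by
    rw [Fintype.card_prod, D.card]; push_cast; ring
  rw [hcard]
  have hy : ∀ x, ‖pairRep θ r x * p ^ j‖ ≤ ‖p‖ ^ j := fun x => by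
    rw [norm_mul, norm_pow]
    exact mul_le_of_le_one_left (by positivity) (D.norm_pairRep_le x)
  have hpj : ‖p‖ ^ (2 * j) = ‖p‖ ^ j * ‖p‖ ^ j := by rw [two_mul, pow_add]
  have hy2 : ∀ x, ‖pairRep θ r x * p ^ j‖ ^ 2 ≤ ‖p‖ ^ (2 * j) := fun x => by
    rw [hpj, sq]
    exact mul_self_le_mul_self (norm_nonneg _) (hy x)
  have hmid : ∀ x w, IsSphere σ c w → ‖w 1‖ ≤ ‖p‖ ^ j →
      ‖σ (pairRep θ r x * p ^ j) * w 1‖ ≤ ‖p‖ ^ (2 * j) := by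
    intro x w hw h1
    rw [norm_mul, D.norm_conj, hpj]
    exact mul_le_mul (hy x) h1 (norm_nonneg _) (by positivity)
  -- The moves translate `w₁` by `p^j` times every residue times `w₀`, and change `w₂` only by
  -- multiples of `p^(2j)`, because `p^j` divides `w₁`.
  refine card_mul_orbitMass μ hv (isClosed_unitTailSet _ _)
    (isClosed_normTailSet D.continuous_conj _ _ _)
    (fun x => lowerMap σ θ (pairRep θ r x * p ^ j) 0) ?_ n ?_ ?_
  · intro x
    exact exists_lowerMap D ((hy x).trans (D.pow_le_one j)) (by simp) (map_zero σ)
  · rintro w hw ⟨h0, h2⟩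
    have h1 : ‖w 1‖ ≤ ‖p‖ ^ j := D.norm_le_pow_of_sq_le
      (IsSphere.norm_one_sq_le D hc (hw.norm_sub_le D (Or.inr h2))) (by omega)
    rw [← hn (w 1 / p ^ j) (w 0) (by
      rw [norm_div, norm_pow]
      exact div_le_one_of_le₀ h1 (by positivity)) h0]
    refine Nat.card_congr (Equiv.subtypeEquivRight fun x => ?_)
    have h3 : c - (w 1 + pairRep θ r x * p ^ j * w 0) * σ (w 1 + pairRep θ r x * p ^ j * w 0) =
        p ^ (2 * j) * (c / p ^ (2 * j) -
        (w 1 / p ^ j + pairRep θ r x * w 0) * σ (w 1 / p ^ j + pairRep θ r x * w 0)) := by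
      simp only [map_add, map_mul, map_pow, map_div₀, D.conj_prime]
      field_simp
      ring
    have h4 : ‖c / p ^ (2 * j) - (w 1 / p ^ j + pairRep θ r x * w 0) *
        σ (w 1 / p ^ j + pairRep θ r x * w 0)‖ < 1 ↔
        ‖c - (w 1 + pairRep θ r x * p ^ j * w 0) * σ (w 1 + pairRep θ r x * p ^ j * w 0)‖ ≤
          ‖p‖ ^ (2 * j + 1) := by
      rw [h3, ← D.norm_lt_pow_iff, norm_mul, norm_pow]
      exact (mul_lt_iff_lt_one_right (pow_pos D.prime_pos _)).symm
    rw [h4]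
    refine ⟨fun h => h.2.2, fun h => ⟨h0, ?_, h⟩⟩
    exact norm_add_le_of_le (norm_sub_le_of_le h2 (hmid x w hw h1))
      (norm_lowerMap_sub_le D h0.le (hy2 x))
  · rintro w hw x hTw ⟨h0, h2, h3⟩
    have h0' : ‖w 0‖ = 1 := h0
    have h1 : ‖w 1‖ ≤ ‖p‖ ^ j := by
      have h4 := D.norm_le_pow_of_sq_le (j := j) (IsSphere.norm_one_sq_le D hc
        (h3.trans (D.pow_le (2 * j).le_succ))) (by omega)
      have h5 : w 1 = (lowerMap σ θ (pairRep θ r x * p ^ j) 0 w) 1 -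
          pairRep θ r x * p ^ j * w 0 := by simp [lowerMap]
      rw [h5]
      refine norm_sub_le_of_le h4 ?_
      rw [norm_mul, h0', mul_one]
      exact hy x
    refine ⟨h0', ?_⟩
    have h5 : w 2 = (lowerMap σ θ (pairRep θ r x * p ^ j) 0 w) 2 +
        σ (pairRep θ r x * p ^ j) * w 1 - (0 * (2 * θ - 1) - pairRep θ r x * p ^ j *
          σ (pairRep θ r x * p ^ j) * θ) * w 0 := by
      simp only [lowerMap, Matrix.cons_val]
      ring
    rw [h5]
    exact norm_sub_le_of_le (norm_add_le_of_le h2 (hmid x w hw h1))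
      (norm_lowerMap_sub_le D h0'.le (hy2 x))

/-- Here `c / p^(2j)` reduces to 0, and only the zero residue has norm 0; so `n = 1`. The exponent 3
is 2 from these moves plus 1 from `orbitMass_normTailSet`. -/
theorem orbitMass_unitTailSet_of_lt (D : UnramifiedData σ q p θ r) (hv : IsSphere σ c v) {j : ℕ}
    (hc : ‖c‖ < ‖p‖ ^ (2 * j)) :
    (q : ℝ) ^ 3 * orbitMass μ v (unitTailSet p (2 * j + 1)) =
      orbitMass μ v (unitTailSet p (2 * j)) := by
  have h := orbitMass_normTailSet_even μ D hv hc.le 1 ?_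
  · rw [← orbitMass_normTailSet μ D hv, Nat.cast_one, one_mul] at h
    rw [← h]; ring
  · intro u w hu hw
    have hw0 : w ≠ 0 := norm_pos_iff.1 (hw ▸ one_pos)
    have h1 := card_subtype_eq_one (D.existsUnique_pairRep hw0 (hu.trans hw.ge))
    rw [← h1]
    refine Nat.card_congr (Equiv.subtypeEquivRight fun x => ?_)
    have hc1 : ‖c / p ^ (2 * j)‖ < 1 := by
      rw [norm_div, norm_pow]
      exact (div_lt_one (pow_pos D.prime_pos _)).2 hc
    have h2 : ‖u + pairRep θ r x * w‖ < ‖w‖ ↔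
        ‖(u + pairRep θ r x * w) * σ (u + pairRep θ r x * w)‖ < 1 := by
      rw [D.norm_mul_conj, hw, sq_lt_one_iff₀ (norm_nonneg _)]
    rw [mul_comm w, h2]
    constructor
    · intro h
      have := norm_sub_lt_of_lt hc1 h
      rwa [sub_sub_cancel] at this
    · exact norm_sub_lt_of_lt hc1

/-- Now `c / p^(2j)` is a unit, and its residue is a norm in `q + 1` ways. -/
theorem orbitMass_unitTailSet_of_eq (D : UnramifiedData σ q p θ r) (hv : IsSphere σ c v) {j : ℕ}
    (hc : ‖c‖ = ‖p‖ ^ (2 * j)) :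
    (q : ℝ) ^ 3 * orbitMass μ v (unitTailSet p (2 * j + 1)) =
      (q + 1) * orbitMass μ v (unitTailSet p (2 * j)) := by
  have h := orbitMass_normTailSet_even μ D hv hc.le (q + 1) ?_
  · rw [← orbitMass_normTailSet μ D hv] at h
    push_cast at h
    rw [← h]; ring
  · intro u w hu hw
    refine D.card_affine_norm hu hw ?_ ?_
    · rw [map_div₀, map_pow, D.conj_prime, hv.conj_eq D]
    · rw [norm_div, norm_pow, hc, div_self (pow_pos D.prime_pos _).ne']

end UnitaryHermitian

namespace UnitaryHermitian

/-! ### The recurrence for the tail masses. -/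

/-- The recurrence satisfied by the masses `f i` of the vectors `w` with `p ^ i ∣ w 2` on the sphere
of vectors whose hermitian form has valuation `m`. -/
structure TailRecurrence (q : ℝ) (m : ℕ) (f : ℕ → ℝ) : Prop where
  zero : f 0 = 1
  one_of_zero : m = 0 → (q ^ 3 + 1) * f 1 = q + 1
  one_of_ne_zero : m ≠ 0 → (q ^ 3 + 1) * f 1 = 1
  odd_lt : ∀ i, Odd i → i < m → q * f (i + 1) = f i
  even_lt : ∀ i, Even i → i ≠ 0 → i < m → q ^ 3 * f (i + 1) = f i
  even_top : Even m → m ≠ 0 → q ^ 3 * f (m + 1) = (q + 1) * f m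
  odd_top : Odd m → ∀ i, m < i → f i = 0
  even_tail : Even m → ∀ i, m < i → q ^ 2 * f (i + 1) = f i

variable {k k' : Type*} [NontriviallyNormedField k] [NormedField k'] [NormedAlgebra k k']
  {σ : k' ≃ₐ[k] k'} {c : k'} {q : ℕ} {p θ : k'} {κ : Type*} [Fintype κ] {r : κ → k'}
  [IsUltrametricDist k']

/-- Since `w₁` has valuation exactly `l`, the linear term `σ(y)w₁` runs once through the multiples
of `p^(n+l)` modulo `p^(n+l+1)`; `h0` makes the quadratic term negligible. -/
theorem card_lowerMap_tail (D : UnramifiedData σ q p θ r) {l n : ℕ} {w : Fin 3 → k'}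
    (h1 : ‖w 1‖ = ‖p‖ ^ l) (h2 : ‖w 2‖ ≤ ‖p‖ ^ (n + l))
    (h0 : ‖p‖ ^ (2 * n) * ‖w 0‖ ≤ ‖p‖ ^ (n + l + 1)) :
    Nat.card {x : κ × κ // ‖lowerMap σ θ (pairRep θ r x * p ^ n) 0 w 2‖ ≤ ‖p‖ ^ (n + l + 1)}
      = 1 := by
  have hp := D.prime_ne_zero
  have hw1 : w 1 ≠ 0 := norm_pos_iff.1 (h1 ▸ pow_pos D.prime_pos l)
  have ha : ‖-(p ^ n * σ (w 1))‖ = ‖p‖ ^ (n + l) := by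
    rw [norm_neg, norm_mul, norm_pow, D.norm_conj, h1, pow_add]
  refine Eq.trans ?_ (card_subtype_eq_one
    (D.existsUnique_pairRep (a := -(p ^ n * σ (w 1))) (b := σ (w 2)) (by simp [hp, hw1])
      (by rwa [ha, D.norm_conj])))
  refine Nat.card_congr (Equiv.subtypeEquivRight fun x => ?_)
  have h3 : σ (w 2) + -(p ^ n * σ (w 1)) * pairRep θ r x =
      σ (w 2 - σ (pairRep θ r x * p ^ n) * w 1) := by
    simp only [map_sub, map_mul, map_pow, D.conj_conj, D.conj_prime]
    ring
  have h4 : ‖(0 * (2 * θ - 1) - pairRep θ r x * p ^ n *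
      σ (pairRep θ r x * p ^ n) * θ) * w 0‖ ≤ ‖p‖ ^ (n + l + 1) := by
    refine le_trans ?_ h0
    rw [zero_mul, zero_sub, neg_mul, norm_neg, norm_mul, norm_mul, D.norm_mul_conj, norm_mul,
      norm_pow, mul_pow, ← pow_mul, mul_comm n 2]
    refine mul_le_mul_of_nonneg_right ?_ (norm_nonneg _)
    refine (mul_le_of_le_one_right (by positivity) D.norm_theta).trans ?_
    exact mul_le_of_le_one_left (by positivity)
      (pow_le_one₀ (norm_nonneg _) (D.norm_pairRep_le x))
  rw [h3, D.norm_conj, ha, D.norm_lt_pow_iff]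
  have h5 : lowerMap σ θ (pairRep θ r x * p ^ n) 0 w 2 = w 2 - σ (pairRep θ r x * p ^ n) * w 1 +
      (0 * (2 * θ - 1) - pairRep θ r x * p ^ n * σ (pairRep θ r x * p ^ n) * θ) * w 0 := rfl
  rw [h5]
  constructor
  · intro h
    have := norm_sub_le_of_le h h4
    rwa [add_sub_cancel_right] at this
  · intro h
    exact norm_add_le_of_le h h4

variable [MeasurableSpace (maxCompact σ 3)] [BorelSpace (maxCompact σ 3)]
  (μ : Measure (maxCompact σ 3)) [μ.IsMulLeftInvariant] [IsProbabilityMeasure μ]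
  {v : Fin 3 → k'}

/-- Beyond the valuation `2l` of `c`, the sphere equation forces `w₁` to have valuation `l`, so
exactly one of the `q²` moves by `p^n y` gains a further power of `p` in `w₂`. -/
theorem orbitMass_tailSet_of_lt (D : UnramifiedData σ q p θ r) (hv : IsSphere σ c v) {l n : ℕ}
    (hc : ‖c‖ = ‖p‖ ^ (2 * l)) (hn : l < n) :
    (q : ℝ) ^ 2 * orbitMass μ v (tailSet p (n + l + 1)) = orbitMass μ v (tailSet p (n + l)) := by
  have hlt : ‖p‖ ^ (n + l) < ‖c‖ := hc ▸ D.pow_lt (by omega)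
  have hw1 : ∀ w, IsSphere σ c w → ‖w 2‖ ≤ ‖p‖ ^ (n + l) → ‖w 1‖ = ‖p‖ ^ l := by
    intro w hw h2
    have := IsSphere.norm_one_sq_eq D ((hw.norm_sub_le D (Or.inr h2)).trans_lt hlt)
    rw [hc, mul_comm, pow_mul] at this
    exact (pow_left_inj₀ (norm_nonneg _) (pow_nonneg D.prime_pos.le _) two_ne_zero).1 this
  have hy : ∀ x, ‖pairRep θ r x * p ^ n‖ ≤ ‖p‖ ^ n := fun x => by
    rw [norm_mul, norm_pow]
    exact mul_le_of_le_one_left (by positivity) (D.norm_pairRep_le x)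
  suffices h : Fintype.card (κ × κ) * orbitMass μ v (tailSet p (n + l + 1)) =
      (1 : ℕ) * orbitMass μ v (tailSet p (n + l)) by
    rw [Fintype.card_prod, D.card, Nat.cast_one, one_mul] at h
    rw [← h]; push_cast; ring
  refine card_mul_orbitMass μ hv (isClosed_tailSet _ _) (isClosed_tailSet _ _)
    (fun x => lowerMap σ θ (pairRep θ r x * p ^ n) 0) ?_ 1 ?_ ?_
  · intro x
    exact exists_lowerMap D ((hy x).trans (D.pow_le_one n)) (by simp) (map_zero σ)
  · intro w hw h2
    refine card_lowerMap_tail D (hw1 w hw h2) h2 ?_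
    exact (mul_le_of_le_one_right (by positivity) (hw.norm_le 0)).trans (D.pow_le (by omega))
  · intro w hw x hTw h2
    have h2' : ‖lowerMap σ θ (pairRep θ r x * p ^ n) 0 w 2‖ ≤ ‖p‖ ^ (n + l) :=
      le_trans h2 (D.pow_le (n + l).le_succ)
    have h3 := hw1 _ hTw h2'
    have h4 : w 2 = (lowerMap σ θ (pairRep θ r x * p ^ n) 0 w) 2 +
        σ (pairRep θ r x * p ^ n) * (lowerMap σ θ (pairRep θ r x * p ^ n) 0 w) 1 -
        pairRep θ r x * p ^ n * σ (pairRep θ r x * p ^ n) * (1 - θ) * w 0 := by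
      simp only [lowerMap, Matrix.cons_val]
      ring
    change ‖w 2‖ ≤ _
    rw [h4]
    refine norm_sub_le_of_le (norm_add_le_of_le h2' ?_) ?_
    · rw [norm_mul, D.norm_conj, h3, pow_add]
      exact mul_le_mul_of_nonneg_right (hy x) (by positivity)
    · rw [norm_mul, norm_mul, D.norm_mul_conj, ← D.conj_theta, D.norm_conj]
      refine (mul_le_of_le_one_right (by positivity) (hw.norm_le 0)).trans ?_
      refine (mul_le_of_le_one_right (by positivity) D.norm_theta).trans ?_
      refine (pow_le_pow_left₀ (norm_nonneg _) (hy x) 2).trans ?_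
      rw [← pow_mul]
      exact D.pow_le (by omega)

/-- Vectors whose first entry is not a unit. -/
def headSet (p : k') : Set (Fin 3 → k') := {w | ‖w 0‖ ≤ ‖p‖}

omit [IsUltrametricDist k'] in
theorem isClosed_headSet (p : k') : IsClosed (headSet p) :=
  isClosed_le (by fun_prop) continuous_const

-- Swapping the outer coordinates is an element of `K`.
omit [IsProbabilityMeasure μ] in
theorem orbitMass_headSet : orbitMass μ v (headSet p) = orbitMass μ v (tailSet p 1) := by
  obtain ⟨g, hg⟩ := exists_swap σ
  rw [← orbitMass_preimage μ v (headSet p) g]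
  congr 1
  ext w
  simp [hg, headSet, tailSet]

theorem orbitMass_unitTailSet_zero (D : UnramifiedData σ q p θ r) (hv : IsSphere σ c v) :
    orbitMass μ v (unitTailSet p 0) = 1 - orbitMass μ v (tailSet p 1) := by
  rw [← orbitMass_headSet, orbitMass, orbitMass,
    ← probReal_compl_eq_one_sub (measurableSet_orbit v (isClosed_headSet p))]
  congr 1
  ext h
  have hw := hv.mulVec h
  set w := (h : GL (Fin 3) k').val.mulVec v
  change (‖w 0‖ = 1 ∧ ‖w 2‖ ≤ ‖p‖ ^ 0) ↔ ¬ ‖w 0‖ ≤ ‖p‖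
  rw [← D.norm_lt_one_iff, not_lt, pow_zero]
  exact ⟨fun h => h.1.ge, fun h => ⟨le_antisymm (hw.norm_le 0) h, hw.norm_le 2⟩⟩

/-- When `c` is a unit and `w₀` is not, `w₁` must be a unit, so exactly one residue `y` makes `w₂`
divisible by `p`. -/
theorem orbitMass_headSet_inter (D : UnramifiedData σ q p θ r) (hv : IsSphere σ c v)
    (hc : ‖c‖ = 1) : (q : ℝ) ^ 2 * orbitMass μ v (headSet p ∩ tailSet p 1) =
      orbitMass μ v (tailSet p 1) := by
  rw [← orbitMass_headSet]
  suffices h : Fintype.card (κ × κ) * orbitMass μ v (headSet p ∩ tailSet p 1) =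
      (1 : ℕ) * orbitMass μ v (headSet p) by
    rw [Fintype.card_prod, D.card, Nat.cast_one, one_mul] at h
    rw [← h]; push_cast; ring
  refine card_mul_orbitMass μ hv (isClosed_headSet _)
    ((isClosed_headSet _).inter (isClosed_tailSet _ _))
    (fun x => lowerMap σ θ (pairRep θ r x * p ^ 0) 0) ?_ 1 ?_ ?_
  · intro x
    exact exists_lowerMap D (by simpa using D.norm_pairRep_le x) (by simp) (map_zero σ)
  · intro w hw h0
    have h0' : ‖w 0‖ ≤ ‖p‖ := h0
    have h1 := IsSphere.norm_one_sq_eq D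
      ((hw.norm_sub_le D (Or.inl h0')).trans_lt (hc ▸ D.prime_lt_one))
    rw [hc, pow_eq_one_iff_of_nonneg (norm_nonneg _) two_ne_zero] at h1
    refine Eq.trans ?_ (card_lowerMap_tail D (l := 0) (n := 0) (w := w) (by simpa using h1)
      (by simpa using hw.norm_le 2) (by simpa using h0'))
    exact Nat.card_congr (Equiv.subtypeEquivRight fun x => and_iff_right h0)
  · intro w hw x hTw h
    exact h.1

-- If `c` and `w₂` are nonunits, so is `w₁`; primitivity leaves only `w₀` to be a unit.
omit [BorelSpace (maxCompact σ 3)] [μ.IsMulLeftInvariant] [IsProbabilityMeasure μ] in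
theorem orbitMass_tailSet_eq (D : UnramifiedData σ q p θ r) (hv : IsSphere σ c v)
    (hc : ‖c‖ < 1) {i : ℕ} (hi : i ≠ 0) :
    orbitMass μ v (tailSet p i) = orbitMass μ v (unitTailSet p i) := by
  refine orbitMass_congr μ hv fun w hw => ⟨fun h2 => ⟨?_, h2⟩, fun h => h.2⟩
  have h2' : ‖w 2‖ ≤ ‖p‖ ^ i := h2
  have h2lt : ‖w 2‖ ≤ ‖p‖ := h2'.trans (by simpa using D.pow_le (Nat.one_le_iff_ne_zero.2 hi))
  have h1 := IsSphere.norm_one_sq_le D (D.norm_lt_one_iff.1 hc) (hw.norm_sub_le D (Or.inr h2lt))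
  obtain ⟨l, hl⟩ := hw.exists_norm_eq
  fin_cases l
  · exact hl
  · simp only [Fin.mk_one, Fin.isValue] at hl
    rw [hl, one_pow] at h1
    exact absurd h1 (not_le.2 D.prime_lt_one)
  · simp only [Fin.reduceFinMk, Fin.isValue] at hl
    rw [hl] at h2lt
    exact absurd h2lt (not_le.2 D.prime_lt_one)

theorem tailRecurrence (D : UnramifiedData σ q p θ r) (hv : IsSphere σ c v) {m : ℕ}
    (hc : ‖c‖ = ‖p‖ ^ m) : TailRecurrence q m fun i => orbitMass μ v (tailSet p i) := by
  have hclt : m ≠ 0 → ‖c‖ < 1 := fun hm => by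
    rw [hc]; simpa using D.pow_lt (Nat.pos_of_ne_zero hm)
  refine ⟨?_, ?_, ?_, ?_, ?_, ?_, ?_, ?_⟩
  · rw [← probReal_univ (μ := μ), orbitMass]
    congr 1
    ext h
    simpa [tailSet] using (hv.mulVec h).norm_le 2
  · rintro rfl
    rw [pow_zero] at hc
    have h1 := orbitMass_unitTailSet_of_eq μ D hv (j := 0) (by simpa using hc)
    have h2 := orbitMass_headSet_inter μ D hv hc
    -- For a unit `c`, primitivity can come from `w₁` alone, so vectors with nonunit `w₀` contribute
    -- a second piece.
    have h3 : orbitMass μ v (tailSet p 1) =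
        orbitMass μ v (unitTailSet p 1) + orbitMass μ v (headSet p ∩ tailSet p 1) := by
      rw [orbitMass, orbitMass, orbitMass, ← measureReal_union ?_
        (measurableSet_orbit v ((isClosed_headSet _).inter (isClosed_tailSet _ _)))]
      · congr 1
        ext h
        have hw := hv.mulVec h
        set w := (h : GL (Fin 3) k').val.mulVec v
        change ‖w 2‖ ≤ _ ↔ (‖w 0‖ = 1 ∧ ‖w 2‖ ≤ _) ∨ (‖w 0‖ ≤ ‖p‖ ∧ ‖w 2‖ ≤ _)
        rw [← D.norm_lt_one_iff, ← or_and_right, or_comm, ← le_iff_lt_or_eq]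
        exact (and_iff_right (hw.norm_le 0)).symm
      · rw [Set.disjoint_left]
        rintro h ⟨h0, -⟩ ⟨h0', -⟩
        have h0'' : ‖(h : GL (Fin 3) k').val.mulVec v 0‖ ≤ ‖p‖ := h0'
        rw [h0] at h0''
        exact absurd h0'' (not_le.2 D.prime_lt_one)
    rw [mul_zero, orbitMass_unitTailSet_zero μ D hv, zero_add] at h1
    change ((q : ℝ) ^ 3 + 1) * orbitMass μ v (tailSet p 1) = q + 1
    linear_combination (q : ℝ) ^ 3 * h3 + h1 + q * h2
  · intro hm
    have h1 := orbitMass_unitTailSet_of_lt μ D hv (j := 0) (by simpa using hclt hm)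
    rw [mul_zero, orbitMass_unitTailSet_zero μ D hv, zero_add,
      ← orbitMass_tailSet_eq μ D hv (hclt hm) one_ne_zero] at h1
    change ((q : ℝ) ^ 3 + 1) * orbitMass μ v (tailSet p 1) = 1
    linear_combination h1
  · intro i hi him
    have hm : m ≠ 0 := by omega
    obtain ⟨j, rfl⟩ := hi
    rw [orbitMass_tailSet_eq μ D hv (hclt hm) (by omega),
      orbitMass_tailSet_eq μ D hv (hclt hm) (by omega), orbitMass_normTailSet μ D hv]
    -- For odd `i = 2j + 1 < m`, `p^(j+1)` divides `w₁`, so `c` and the norm of `w₁` are both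
    -- divisible by `p^(i+1)`: the norm condition is automatic.
    refine orbitMass_congr μ hv fun w hw => ⟨fun h => ⟨h.1, h.2.1⟩, fun h => ⟨h.1, h.2, ?_⟩⟩
    have h1 := D.norm_le_pow_of_sq_le (j := j + 1) (IsSphere.norm_one_sq_le D
      (hc.trans_le (D.pow_le him.le)) (hw.norm_sub_le D (Or.inr h.2))) (by omega)
    refine norm_sub_le_of_le (hc.trans_le (D.pow_le him)) ?_
    rw [D.norm_mul_conj]
    refine (pow_le_pow_left₀ (norm_nonneg _) h1 2).trans ?_
    rw [← pow_mul]
    exact D.pow_le (by omega)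
  · intro i hi hi0 him
    obtain ⟨j, hj⟩ := hi
    rw [← two_mul] at hj
    subst hj
    rw [orbitMass_tailSet_eq μ D hv (hclt (by omega)) (by omega),
      orbitMass_tailSet_eq μ D hv (hclt (by omega)) (by omega)]
    exact orbitMass_unitTailSet_of_lt μ D hv (hc.trans_lt (D.pow_lt him))
  · intro hm hm0
    obtain ⟨j, hj⟩ := hm
    rw [← two_mul] at hj
    subst hj
    rw [orbitMass_tailSet_eq μ D hv (hclt (by omega)) (by omega),
      orbitMass_tailSet_eq μ D hv (hclt (by omega)) (by omega)]
    exact orbitMass_unitTailSet_of_eq μ D hv hc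
  · intro hm i hi
    rw [orbitMass]
    convert measureReal_empty
    rw [Set.eq_empty_iff_forall_notMem]
    intro h h2
    have h2' : ‖(h : GL (Fin 3) k').val.mulVec v 2‖ ≤ ‖p‖ ^ i := h2
    have hw := hv.mulVec h
    have h1 := IsSphere.norm_one_sq_eq D
      ((hw.norm_sub_le D (Or.inr h2')).trans_lt (hc ▸ D.pow_lt hi))
    obtain ⟨j, rfl⟩ := hm
    have h0 : (h : GL (Fin 3) k').val.mulVec v 1 ≠ 0 := by
      intro h0
      rw [h0, norm_zero, hc] at h1
      exact absurd h1.symm (by simpa using D.prime_ne_zero)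
    -- `|w₁|² = |c|` is impossible when the valuation of `c` is odd, so the set is empty.
    obtain ⟨n, hn⟩ := D.norm_eq_pow _ h0 (hw.norm_le 1)
    rw [hn, hc, ← pow_mul] at h1
    have := pow_right_injective₀ D.prime_pos D.prime_lt_one.ne h1
    omega
  · intro hm i hi
    obtain ⟨l, hl⟩ := hm
    rw [← two_mul] at hl
    subst hl
    obtain ⟨n, rfl⟩ : ∃ n, i = n + l := ⟨i - l, by omega⟩
    exact orbitMass_tailSet_of_lt μ D hv hc (by omega)

end UnitaryHermitian

namespace UnitaryHermitian

/-! ### Summing the generating series of the masses. -/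

theorem HasSum.of_eq {f g : ℕ → ℂ} {a b : ℂ} (h : HasSum f a) (hfg : ∀ i, g i = f i)
    (hab : b = a) : HasSum g b := by
  rw [hab, funext hfg]
  exact h

namespace TailRecurrence

variable {q : ℝ} {f : ℕ → ℝ}

/-- The sum of `∑ f (i + 1) X ^ i`, cleared of its denominator `(q ^ 3 + 1) (1 - Y ^ 2)`, with
`X = q ^ 2 Y`. -/
noncomputable def tailSum (q : ℂ) (m : ℕ) (Y : ℂ) : ℂ :=
  if Even m then (1 + q * Y) * (1 - Y ^ m) + (q + 1) * (1 + Y) * Y ^ m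
  else (1 + q * Y) * (1 - Y ^ (m - 1)) + (1 - Y ^ 2) * Y ^ (m - 1)

theorem eq_geometric (hq : 0 < q) (h : TailRecurrence q 0 f) (i : ℕ) :
    f (i + 1) = (q + 1) / (q ^ 3 + 1) * ((q ^ 2)⁻¹) ^ i := by
  have h3 : q ^ 3 + 1 ≠ 0 := by positivity
  induction i with
  | zero =>
    have := h.one_of_zero rfl
    rw [pow_zero, mul_one, eq_div_iff h3, zero_add]
    linarith
  | succ i ih =>
    have := h.even_tail Even.zero (i + 1) (Nat.succ_pos i)
    rw [ih] at this
    rw [pow_succ (q ^ 2)⁻¹ i, ← mul_assoc, ← this]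
    field_simp

/-- Removing two terms of a solution for `m + 2` gives a multiple of a solution for `m`. -/
theorem shift {m : ℕ} (h : TailRecurrence q (m + 2) f) :
    TailRecurrence q m fun i => if i = 0 then 1 else q ^ 4 * f (i + 2) := by
  have h1 := h.one_of_ne_zero (by omega)
  have h2 := h.odd_lt 1 odd_one (by omega)
  -- The value at 0 has to be reset to 1, since `q⁴ f 2 = q³ / (q³ + 1)`. The old relation at the
  -- top index supplies the new initial value when `m = 0`.
  refine ⟨rfl, ?_, ?_, ?_, ?_, ?_, ?_, ?_⟩
  · rintro rfl
    have h3 := h.even_top ⟨1, rfl⟩ (by omega)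
    simp only [zero_add, Nat.reduceAdd, one_ne_zero, if_false] at h1 h2 h3 ⊢
    linear_combination (q ^ 3 + 1) * q * h3 + (q + 1) * (q ^ 3 + 1) * h2 + (q + 1) * h1
  · intro hm
    have h3 := h.even_lt 2 ⟨1, rfl⟩ (by omega) (by omega)
    simp only [Nat.reduceAdd, one_ne_zero, if_false] at h1 h2 h3 ⊢
    linear_combination (q ^ 3 + 1) * q * h3 + (q ^ 3 + 1) * h2 + h1
  · intro i hi him
    have hi0 : i ≠ 0 := by rintro rfl; exact absurd hi (by decide)
    have h3 := h.odd_lt (i + 2) (by rwa [Nat.odd_add, iff_true_right even_two]) (by omega)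
    simp only [hi0, Nat.succ_ne_zero, if_false]
    rw [show i + 1 + 2 = i + 2 + 1 by ring]
    linear_combination q ^ 4 * h3
  · intro i hi hi0 him
    have h3 := h.even_lt (i + 2) (by rwa [Nat.even_add, iff_true_right even_two]) (by omega)
      (by omega)
    simp only [hi0, Nat.succ_ne_zero, if_false]
    rw [show i + 1 + 2 = i + 2 + 1 by ring]
    linear_combination q ^ 4 * h3
  · intro hm hm0
    have h3 := h.even_top (by rwa [Nat.even_add, iff_true_right even_two]) (by omega)
    simp only [hm0, Nat.succ_ne_zero, if_false]
    rw [show m + 1 + 2 = m + 2 + 1 by ring]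
    linear_combination q ^ 4 * h3
  · intro hm i hi
    have h3 := h.odd_top (by rwa [Nat.odd_add, iff_true_right even_two]) (i + 2) (by omega)
    simp [show i ≠ 0 by omega, h3]
  · intro hm i hi
    have h3 := h.even_tail (by rwa [Nat.even_add, iff_true_right even_two]) (i + 2) (by omega)
    simp only [show i ≠ 0 by omega, Nat.succ_ne_zero, if_false]
    rw [show i + 1 + 2 = i + 2 + 1 by ring]
    linear_combination q ^ 4 * h3

/-- Induction on `m` in steps of 2. For `m = 0` the series is geometric in `Y`, for `m = 1` it has
one term; in general two terms split off and `shift` turns the rest into `Y²` times the series for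
`m`. -/
theorem hasSum_tail (hq : 1 < q) {m : ℕ} (h : TailRecurrence q m f) {Y : ℂ} (hY : ‖Y‖ < 1) :
    HasSum (fun i => (f (i + 1) : ℂ) * ((q : ℂ) ^ 2 * Y) ^ i)
      (tailSum q m Y / (((q : ℂ) ^ 3 + 1) * (1 - Y ^ 2))) := by
  have hq0 : (0 : ℝ) < q := one_pos.trans hq
  have hqc : (q : ℂ) ≠ 0 := by exact_mod_cast hq0.ne'
  have h3 : q ^ 3 + 1 ≠ 0 := by positivity
  have h3c : (q : ℂ) ^ 3 + 1 ≠ 0 := by exact_mod_cast h3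
  have hY1 : 1 - Y ≠ 0 := by
    intro h0
    rw [← sub_eq_zero.1 h0, norm_one] at hY
    exact lt_irrefl _ hY
  have hY2 : 1 + Y ≠ 0 := by
    intro h0
    rw [← norm_neg, ← eq_neg_of_add_eq_zero_left h0, norm_one] at hY
    exact lt_irrefl _ hY
  have hYY : 1 - Y ^ 2 ≠ 0 := by
    rw [show 1 - Y ^ 2 = (1 - Y) * (1 + Y) by ring]
    exact mul_ne_zero hY1 hY2
  induction m using Nat.twoStepInduction generalizing f with
  | zero =>
    have h1 := (hasSum_geometric_of_norm_lt_one hY).mul_left (((q : ℂ) + 1) / ((q : ℂ) ^ 3 + 1))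
    refine HasSum.of_eq h1 (fun i => ?_) ?_
    · rw [h.eq_geometric hq0]
      push_cast
      rw [mul_pow, inv_pow]
      field_simp
    · simp only [tailSum, Even.zero, if_true, pow_zero]
      rw [show 1 - Y ^ 2 = (1 - Y) * (1 + Y) by ring]
      field_simp
      ring
  | one =>
    have h1 := hasSum_single (f := fun i => (f (i + 1) : ℂ) * ((q : ℂ) ^ 2 * Y) ^ i) 0 (by
      intro i hi
      rw [h.odd_top odd_one (i + 1) (by omega)]
      simp)
    refine HasSum.of_eq h1 (fun _ => rfl) ?_
    have h2 := h.one_of_ne_zero one_ne_zero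
    have h2c : ((q : ℂ) ^ 3 + 1) * f 1 = 1 := by exact_mod_cast h2
    simp only [tailSum, Nat.not_even_one, if_false]
    rw [div_eq_iff (mul_ne_zero h3c hYY)]
    simp only [zero_add, pow_zero]
    linear_combination -(1 - Y ^ 2) * h2c
  | more m ih _ =>
    have h1 := ih (h.shift)
    simp only [Nat.succ_ne_zero, if_false] at h1
    have h2 := h1.mul_left (Y ^ 2)
    rw [← hasSum_nat_add_iff' 2]
    refine HasSum.of_eq h2 (fun i => ?_) ?_
    · rw [show i + 2 + 1 = i + 1 + 2 by ring]
      push_cast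
      ring
    · have e1 := h.one_of_ne_zero (by omega)
      have e2 := h.odd_lt 1 odd_one (by omega)
      have e1c : ((q : ℂ) ^ 3 + 1) * f 1 = 1 := by exact_mod_cast e1
      have e2c : (q : ℂ) * f 2 = f 1 := by exact_mod_cast e2
      have e3 : (f 1 : ℂ) = 1 / ((q : ℂ) ^ 3 + 1) := by
        rw [eq_div_iff h3c, mul_comm, e1c]
      have e4 : (f 2 : ℂ) = 1 / (((q : ℂ) ^ 3 + 1) * q) := by
        rw [eq_div_iff (mul_ne_zero h3c hqc)]
        linear_combination ((q : ℂ) ^ 3 + 1) * e2c + e1c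
      simp only [Finset.sum_range_succ, Finset.sum_range_zero, zero_add, pow_zero, Nat.reduceAdd,
        e3, e4]
      have key : tailSum q (m + 2) Y = (1 + q * Y) * (1 - Y ^ 2) + Y ^ 2 * tailSum q m Y := by
        simp only [tailSum, Nat.even_add, even_two, iff_true]
        split_ifs with hm
        · ring
        · obtain ⟨n, rfl⟩ := Nat.not_even_iff_odd.1 hm
          rw [show 2 * n + 1 + 2 - 1 = 2 * n + 2 by omega, Nat.add_sub_cancel]
          ring
      rw [key]
      field_simp
      ring

/-- The generating series of the masses `f i - f (i + 1)`. -/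
theorem hasSum_sub (hq : 1 < q) {m : ℕ} (h : TailRecurrence q m f) {U : ℂ}
    (hU : ‖U‖ < 1) :
    HasSum (fun i => ((f i - f (i + 1) : ℝ) : ℂ) * (-(q : ℂ) ^ 2 * U) ^ i)
      ((q - U) * (((q : ℂ) ^ 2 + U) - U ^ m * ((q : ℂ) ^ 2 * U + 1)) /
        (((q : ℂ) ^ 3 + 1) * (1 - U ^ 2))) := by
  have hq0 : (0 : ℝ) < q := one_pos.trans hq
  have h3c : (q : ℂ) ^ 3 + 1 ≠ 0 := by exact_mod_cast (by positivity : q ^ 3 + 1 ≠ 0)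
  have hUU : 1 - U ^ 2 ≠ 0 := by
    intro h0
    have h1 : ‖U‖ ^ 2 = 1 := by rw [← norm_pow, ← sub_eq_zero.1 h0, norm_one]
    rw [pow_eq_one_iff_of_nonneg (norm_nonneg _) two_ne_zero] at h1
    exact hU.ne h1
  have h1 := h.hasSum_tail hq (Y := -U) (by rwa [norm_neg])
  rw [mul_neg, ← neg_mul] at h1
  set X : ℂ := -(q : ℂ) ^ 2 * U with hX
  have h2 : HasSum (fun i => (f i : ℂ) * X ^ i)
      (X * (tailSum q m (-U) / (((q : ℂ) ^ 3 + 1) * (1 - (-U) ^ 2))) + 1) := by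
    rw [← hasSum_nat_add_iff' 1]
    refine HasSum.of_eq (h1.mul_left X) (fun i => ?_) ?_
    · ring
    · simp [h.zero]
  refine HasSum.of_eq (h2.sub h1) (fun i => ?_) ?_
  · push_cast
    ring
  · rw [neg_sq, div_eq_iff (mul_ne_zero h3c hUU)]
    field_simp
    simp only [tailSum]
    split_ifs with hm
    · rw [hm.neg_pow, hX]
      ring
    · obtain ⟨n, rfl⟩ := Nat.not_even_iff_odd.1 hm
      rw [Nat.add_sub_cancel, (even_two_mul n).neg_pow, hX]
      ring

end TailRecurrence

end UnitaryHermitian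

namespace UnitaryHermitian

/-! ### The integral as a sum over shells. -/

theorem ofReal_zpow_cpow {q : ℕ} (hq : 0 < q) (a : ℤ) (s : ℂ) :
    (((q : ℝ) ^ a : ℝ) : ℂ) ^ s = ((q : ℂ) ^ s) ^ a := by
  have hq' : (0 : ℝ) < q := by exact_mod_cast hq
  have h1 : (((q : ℝ) ^ a : ℝ) : ℂ) ≠ 0 := by exact_mod_cast (zpow_pos hq' a).ne'
  have h2 : (q : ℂ) ≠ 0 := by exact_mod_cast hq.ne'
  rw [Complex.cpow_def_of_ne_zero h1, Complex.cpow_def_of_ne_zero h2, ← Complex.exp_int_mul,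
    ← Complex.ofReal_log (zpow_pos hq' a).le, Real.log_zpow, ← Complex.natCast_log]
  congr 1
  push_cast
  ring

theorem norm_natCast_cpow_ge_one {q : ℕ} (hq : 0 < q) {s : ℂ} (hs : 0 ≤ s.re) :
    1 ≤ ‖(q : ℂ) ^ s‖ := by
  rw [Complex.norm_natCast_cpow_of_pos hq]
  exact Real.one_le_rpow (by exact_mod_cast hq) hs

variable {k k' : Type*} [NontriviallyNormedField k] [NormedField k'] [NormedAlgebra k k']
  {σ : k' ≃ₐ[k] k'}

open Classical in
theorem absPow_eq (y : Matrix (Fin 3) (Fin 3) k') (s : ℂ) :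
    absPow y s = if ‖y 2 2‖ = 0 then 0 else ((‖y 2 2‖ : ℝ) : ℂ) ^ s := by
  simp only [absPow, norm_eq_zero]

theorem measurable_absPow_aux (s : ℂ) :
    Measurable fun t : ℝ => if t = 0 then (0 : ℂ) else (t : ℂ) ^ s :=
  Measurable.ite (measurableSet_singleton 0) measurable_const
    (Complex.measurable_ofReal.pow_const s)

variable {c : k'} {q : ℕ} {p θ : k'} {κ : Type*} [Fintype κ] {r : κ → k'}
  [IsUltrametricDist k'] [MeasurableSpace (maxCompact σ 3)] [BorelSpace (maxCompact σ 3)]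
  (μ : Measure (maxCompact σ 3)) [IsProbabilityMeasure μ]
  {v : Fin 3 → k'} {x : Matrix (Fin 3) (Fin 3) k'}

theorem integrable_absPow (hv : IsSphere σ c v) {C : ℝ} (hC : 0 ≤ C)
    (hx : ∀ h : maxCompact σ 3, ‖act σ (h : GL (Fin 3) k') x 2 2‖ =
      C * ‖(h : GL (Fin 3) k').val.mulVec v 2‖ ^ 2) {s : ℂ} (hs : 0 ≤ s.re) :
    Integrable (fun h : maxCompact σ 3 => absPow (act σ (h : GL (Fin 3) k') x) s) μ := by
  classical
  refine Integrable.of_bound ?_ (C ^ s.re) (Filter.Eventually.of_forall fun h => ?_)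
  · simp only [absPow_eq, hx]
    refine ((measurable_absPow_aux s).comp (Continuous.measurable ?_)).aestronglyMeasurable
    exact continuous_const.mul (((continuous_apply 2).comp (continuous_orbit v)).norm.pow 2)
  · rw [absPow_eq]
    split_ifs with h0
    · rw [norm_zero]
      exact Real.rpow_nonneg hC _
    · rw [Complex.norm_cpow_eq_rpow_re_of_pos (lt_of_le_of_ne (norm_nonneg _) (Ne.symm h0))]
      refine Real.rpow_le_rpow (norm_nonneg _) ?_ hs
      rw [hx]
      exact mul_le_of_le_one_right hC (pow_le_one₀ (norm_nonneg _) ((hv.mulVec h).norm_le 2))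

variable [μ.IsMulLeftInvariant]

/-- On the shell where `(hv)₂` has valuation `i` the integrand is `q^((m-e)s) q^(-2is)`, and the
shell has mass `f i - f (i + 1)`. The parameter `U` satisfies `-q² U = q^(-2s)`, and `Re s ≥ 0`
gives `|U| < 1`. -/
theorem integral_absPow (D : UnramifiedData σ q p θ r) (hv : IsSphere σ c v) {m e : ℕ}
    (hc : ‖c‖ = ‖p‖ ^ m) (he : ‖(2 : k')‖ = ‖p‖ ^ e)
    (hx : ∀ h : maxCompact σ 3, ‖act σ (h : GL (Fin 3) k') x 2 2‖ =
      ‖(2 : k')‖ / ‖c‖ * ‖(h : GL (Fin 3) k').val.mulVec v 2‖ ^ 2) {s U : ℂ} (hs : 0 ≤ s.re)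
    (hU : U * (q : ℂ) ^ 2 * ((q : ℂ) ^ s) ^ 2 = -1) :
    ∫ h : maxCompact σ 3, absPow (act σ (h : GL (Fin 3) k') x) s ∂μ =
      ((q : ℂ) ^ s) ^ ((m : ℤ) - e) * ((q - U) * (((q : ℂ) ^ 2 + U) - U ^ m *
        ((q : ℂ) ^ 2 * U + 1)) / (((q : ℂ) ^ 3 + 1) * (1 - U ^ 2))) := by
  classical
  have hq2 := D.two_le
  have hq0 : 0 < q := by omega
  have hq0' : (q : ℝ) ≠ 0 := by exact_mod_cast hq0.ne'
  have hq1 : (1 : ℝ) < q := by exact_mod_cast (by omega : 1 < q)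
  set W : ℂ := (q : ℂ) ^ s with hW
  have hW1 : 1 ≤ ‖W‖ := norm_natCast_cpow_ge_one hq0 hs
  have hW0 : W ≠ 0 := norm_pos_iff.1 (one_pos.trans_le hW1)
  have hU1 : ‖U‖ < 1 := by
    have h1 := congrArg norm hU
    rw [norm_mul, norm_mul, norm_pow, norm_pow, norm_neg, norm_one, Complex.norm_natCast] at h1
    have h2 : 1 ≤ ‖W‖ ^ 2 := one_le_pow₀ hW1
    have h3 : 1 < (q : ℝ) ^ 2 := one_lt_pow₀ hq1 two_ne_zero
    nlinarith [norm_nonneg U, mul_le_mul_of_nonneg_left h2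
      (mul_nonneg (norm_nonneg U) (sq_nonneg (q : ℝ)))]
  have hint := integrable_absPow μ hv (by positivity) hx hs
  set F : maxCompact σ 3 → ℂ := fun h => absPow (act σ (h : GL (Fin 3) k') x) s with hF
  let E : ℕ → Set (maxCompact σ 3) := fun i =>
    {h | ‖(h : GL (Fin 3) k').val.mulVec v 2‖ = ‖p‖ ^ i}
  have hEm : ∀ i, MeasurableSet (E i) := fun i =>
    (isClosed_eq ((continuous_apply 2).comp (continuous_orbit v)).norm
      continuous_const).measurableSet
  have hEd : Pairwise (Function.onFun Disjoint E) := by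
    intro i j hij
    rw [Function.onFun, Set.disjoint_left]
    intro h hi hj
    exact hij (pow_right_injective₀ D.prime_pos D.prime_lt_one.ne (hi.symm.trans hj))
  have hF0 : ∀ h, h ∉ ⋃ i, E i → F h = 0 := by
    intro h hh
    have h0 : (h : GL (Fin 3) k').val.mulVec v 2 = 0 := by
      by_contra hne
      obtain ⟨n, hn⟩ := D.norm_eq_pow _ hne ((hv.mulVec h).norm_le 2)
      exact hh (Set.mem_iUnion.2 ⟨n, hn⟩)
    rw [hF]
    simp only [absPow_eq, hx, h0, norm_zero]
    simp
  have hFE : ∀ i, ∀ h ∈ E i, F h = W ^ ((m : ℤ) - e) * (-(q : ℂ) ^ 2 * U) ^ i := by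
    intro i h hh
    have hh' : ‖(h : GL (Fin 3) k').val.mulVec v 2‖ = ‖p‖ ^ i := hh
    have h1 : ‖act σ (h : GL (Fin 3) k') x 2 2‖ = (q : ℝ) ^ ((m : ℤ) - e - 2 * i) := by
      rw [hx, hh', hc, he, D.norm_prime, zpow_sub₀ hq0', zpow_sub₀ hq0', zpow_natCast,
        zpow_natCast, mul_comm (2 : ℤ), zpow_mul, zpow_natCast]
      simp only [inv_pow]
      field_simp
    have h2 : -(q : ℂ) ^ 2 * U = (W ^ 2)⁻¹ := by
      rw [eq_comm, inv_eq_iff_eq_inv, eq_comm, inv_eq_of_mul_eq_one_left]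
      linear_combination -hU
    have h3 : (q : ℝ) ^ ((m : ℤ) - e - 2 * i) ≠ 0 := zpow_ne_zero _ hq0'
    rw [hF]
    simp only [absPow_eq, h1, h3, if_false]
    rw [ofReal_zpow_cpow hq0, zpow_sub₀ hW0 _ (2 * (i : ℤ)), h2, inv_pow, zpow_mul, zpow_natCast,
      div_eq_mul_inv]
    norm_cast
  have hEμ : ∀ i, μ.real (E i) = orbitMass μ v (tailSet p i) - orbitMass μ v (tailSet p (i + 1)) := by
    intro i
    rw [orbitMass, orbitMass, ← measureReal_sdiff ?_ (measurableSet_orbit v (isClosed_tailSet _ _))]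
    · congr 1
      ext h
      change ‖_‖ = _ ↔ ‖_‖ ≤ _ ∧ ¬ ‖_‖ ≤ _
      rw [← D.norm_lt_pow_iff, not_lt, ← le_antisymm_iff]
    · exact fun h hh => le_trans hh (D.pow_le i.le_succ)
  have hsum := hasSum_integral_iUnion (μ := μ) (f := F) hEm hEd hint.integrableOn
  rw [setIntegral_eq_integral_of_forall_compl_eq_zero hF0] at hsum
  have hsum2 := ((tailRecurrence μ D hv hc).hasSum_sub hq1 hU1).mul_left (W ^ ((m : ℤ) - e))
  simp only [Complex.ofReal_natCast] at hsum2
  refine hsum.unique (HasSum.of_eq hsum2 (fun i => ?_) rfl)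
  rw [setIntegral_congr_fun (hEm i) (hFE i), setIntegral_const, hEμ, Complex.real_smul]
  ring

end UnitaryHermitian

namespace UnitaryHermitian

/-! ### The symmetric form behind the functional equation. -/

section Symmetric

variable {R S : Type*} [CommRing R] [CommRing S]

/-- The symmetric homogeneous form
`(a ^ m (q ^ 2 a + b) - b ^ m (q ^ 2 b + a)) / (a - b)` in `a, b`. -/
def symmForm (q a b : R) : ℕ → R
  | 0 => q ^ 2 - 1
  | 1 => q ^ 2 * (a + b)
  | m + 2 => (a + b) * symmForm q a b (m + 1) - a * b * symmForm q a b m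

theorem sub_mul_symmForm (q a b : R) (m : ℕ) :
    (a - b) * symmForm q a b m = a ^ m * (q ^ 2 * a + b) - b ^ m * (q ^ 2 * b + a) := by
  induction m using Nat.twoStepInduction with
  | zero => rw [symmForm]; ring
  | one => rw [symmForm]; ring
  | more m h0 h1 =>
    rw [symmForm]
    linear_combination (a + b) * h1 - a * b * h0

theorem symmForm_comm (q a b : R) (m : ℕ) : symmForm q a b m = symmForm q b a m := by
  induction m using Nat.twoStepInduction with
  | zero => rfl
  | one => rw [symmForm, symmForm, add_comm]
  | more m h0 h1 => rw [symmForm, symmForm, h0, h1, add_comm, mul_comm a b]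

/-- Homogeneity of degree `m`; it both clears denominators in `q^s` and passes from `(1, V²)` to
`(V⁻¹, V)`. -/
theorem symmForm_mul (q a b t : R) (m : ℕ) :
    symmForm q (t * a) (t * b) m = t ^ m * symmForm q a b m := by
  induction m using Nat.twoStepInduction with
  | zero => rw [symmForm, symmForm]; ring
  | one => rw [symmForm, symmForm]; ring
  | more m h0 h1 => rw [symmForm, symmForm, h0, h1]; ring

theorem map_symmForm (f : R →+* S) (q a b : R) (m : ℕ) :
    f (symmForm q a b m) = symmForm (f q) (f a) (f b) m := by
  induction m using Nat.twoStepInduction with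
  | zero => simp [symmForm]
  | one => simp [symmForm]
  | more m h0 h1 => rw [symmForm, symmForm]; simp [h0, h1]

open Polynomial in
/-- The values of `symmForm` at `a b = 1`, as a polynomial in `a + b`. -/
theorem exists_polynomial_symmForm (q : R) (m : ℕ) :
    ∃ P : R[X], ∀ a b, a * b = 1 → P.eval (a + b) = symmForm q a b m := by
  induction m using Nat.twoStepInduction with
  | zero => exact ⟨C (q ^ 2 - 1), fun a b _ => by rw [eval_C]; rfl⟩
  | one => exact ⟨C (q ^ 2) * X, fun a b _ => by rw [eval_mul, eval_C, eval_X]; rfl⟩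
  | more m h0 h1 =>
    obtain ⟨P, hP⟩ := h0
    obtain ⟨Q, hQ⟩ := h1
    refine ⟨X * Q - P, fun a b hab => ?_⟩
    rw [symmForm, eval_sub, eval_mul, eval_X, hP a b hab, hQ a b hab, hab, one_mul]

end Symmetric

/-! ### Evaluation and uniqueness of rational functions. -/

section RationalFunction

open Polynomial

theorem ratFunc_eval_div {K : Type*} [Field K] {P Q : K[X]} {y : K} (hQ : Q.eval y ≠ 0) :
    (algebraMap K[X] (RatFunc K) P / algebraMap K[X] (RatFunc K) Q).denom.eval y ≠ 0 ∧
    (algebraMap K[X] (RatFunc K) P / algebraMap K[X] (RatFunc K) Q).eval (RingHom.id K) y =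
      P.eval y / Q.eval y := by
  have hQ0 : Q ≠ 0 := by rintro rfl; exact hQ eval_zero
  set x := algebraMap K[X] (RatFunc K) P / algebraMap K[X] (RatFunc K) Q with hx
  have hd : x.denom.eval y ≠ 0 := by
    obtain ⟨d, hd⟩ := RatFunc.denom_div_dvd P Q
    rw [← hx] at hd
    intro h0
    rw [hd, eval_mul, h0, zero_mul] at hQ
    exact hQ rfl
  refine ⟨hd, ?_⟩
  have h := congrArg (eval y) ((RatFunc.num_mul_eq_mul_denom_iff hQ0).2 hx)
  rw [eval_mul, eval_mul] at h
  rw [RatFunc.eval, eval₂_id, eval₂_id, div_eq_div_iff hd hQ, h]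

theorem ratFunc_eq_of_infinite {K : Type*} [Field K] {x y : RatFunc K} {s : Set K}
    (hs : s.Infinite) (h : ∀ a ∈ s, x.denom.eval a ≠ 0 ∧ y.denom.eval a ≠ 0 ∧
      x.eval (RingHom.id K) a = y.eval (RingHom.id K) a) : x = y := by
  have h1 : x.num * y.denom = y.num * x.denom := by
    refine eq_of_infinite_eval_eq _ _ (hs.mono fun a ha => ?_)
    obtain ⟨hx, hy, hxy⟩ := h a ha
    rw [RatFunc.eval, RatFunc.eval, eval₂_id, eval₂_id, eval₂_id, eval₂_id,
      div_eq_div_iff hx hy] at hxy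
    rw [Set.mem_ofPred_eq, eval_mul, eval_mul, hxy]
  rw [(RatFunc.num_mul_eq_mul_denom_iff y.denom_ne_zero).1 h1, RatFunc.num_div_denom]

/-- The continuation of the integral, as a rational function of `q ^ s`. -/
noncomputable def continuation (q : ℂ) (e m : ℕ) : RatFunc ℂ :=
  algebraMap ℂ[X] (RatFunc ℂ)
    (X ^ m * (C q * X ^ 2 + C (q ^ 2)⁻¹) * symmForm (C q) (X ^ 2) (C (-(q ^ 2)⁻¹)) m) /
  algebraMap ℂ[X] (RatFunc ℂ)
    (X ^ e * X ^ (2 * m) * C (q ^ 3 + 1) * (X ^ 2 - C (q ^ 2)⁻¹))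

/-- Since `W² U = -q⁻²`, the arguments `W², -q⁻²` in `continuation` are `W²` times `1, U`. Only `1 +
U` remains as a possible pole, because `1 - U` has been absorbed into `symmForm`. -/
theorem continuation_eval {q : ℂ} (hq : q ≠ 0) (hq3 : q ^ 3 + 1 ≠ 0) (e m : ℕ) {W U : ℂ}
    (hU : U * q ^ 2 * W ^ 2 = -1) (hU1 : 1 + U ≠ 0) :
    (continuation q e m).denom.eval W ≠ 0 ∧
    (continuation q e m).eval (RingHom.id ℂ) W =
      W ^ ((m : ℤ) - e) * ((q - U) * symmForm q 1 U m / ((q ^ 3 + 1) * (1 + U))) := by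
  have hW : W ≠ 0 := by
    rintro rfl
    simp at hU
  have h1 : -(q ^ 2)⁻¹ = W ^ 2 * U := by
    field_simp
    linear_combination -hU
  have h1' : (q ^ 2)⁻¹ = -(W ^ 2 * U) := by rw [← h1, neg_neg]
  have hden : (X ^ e * X ^ (2 * m) * C (q ^ 3 + 1) * (X ^ 2 - C (q ^ 2)⁻¹)).eval W =
      W ^ e * W ^ (2 * m) * (q ^ 3 + 1) * (W ^ 2 * (1 + U)) := by
    simp only [eval_mul, eval_pow, eval_X, eval_C, eval_sub]
    rw [h1']
    ring
  have hne : (X ^ e * X ^ (2 * m) * C (q ^ 3 + 1) * (X ^ 2 - C (q ^ 2)⁻¹)).eval W ≠ 0 := by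
    rw [hden]
    simp [hW, hq3, hU1]
  obtain ⟨h2, h3⟩ := ratFunc_eval_div (P := X ^ m * (C q * X ^ 2 + C (q ^ 2)⁻¹) *
    symmForm (C q) (X ^ 2) (C (-(q ^ 2)⁻¹)) m) hne
  refine ⟨h2, h3.trans ?_⟩
  have h4 : eval W (symmForm (C q) (X ^ 2) (C (-(q ^ 2)⁻¹)) m) =
      W ^ (2 * m) * symmForm q 1 U m := by
    rw [← coe_evalRingHom, map_symmForm, pow_mul, ← symmForm_mul]
    simp only [coe_evalRingHom, eval_C, eval_pow, eval_X]
    rw [h1, mul_one]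
  rw [hden, eval_mul, h4]
  simp only [eval_mul, eval_pow, eval_X, eval_C, eval_add]
  rw [h1', zpow_sub₀ hW, zpow_natCast, zpow_natCast]
  field_simp
  ring

end RationalFunction

/-! ### Continuation of the integral and the spherical function. -/

section Continuation

variable {k k' : Type*} [NontriviallyNormedField k] [NormedField k'] [NormedAlgebra k k']
  {σ : k' ≃ₐ[k] k'} {c : k'} {q : ℕ} {p θ : k'} {κ : Type*} [Fintype κ] {r : κ → k'}
  [IsUltrametricDist k] [IsUltrametricDist k'] [MeasurableSpace (maxCompact σ 3)]
  (μ : Measure (maxCompact σ 3))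
  {v : Fin 3 → k'} {x : Matrix (Fin 3) (Fin 3) k'}

/-- Two continuations agree at the infinitely many points `q^n` with `n` natural. -/
theorem IsContinuation.unique (hq : 2 ≤ residueCard k) {R R' : RatFunc ℂ}
    (h : IsContinuation σ μ x R) (h' : IsContinuation σ μ x R') : R = R' := by
  refine ratFunc_eq_of_infinite (s := Set.range fun n : ℕ => (residueCard k : ℂ) ^ n)
    (Set.infinite_range_of_injective fun a b hab => ?_) ?_
  · exact Nat.pow_right_injective hq (by exact_mod_cast hab)
  · rintro _ ⟨n, rfl⟩
    have h1 := h n (by simp)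
    have h2 := h' n (by simp)
    rw [Complex.cpow_natCast] at h1 h2
    exact ⟨h1.1, h2.1, h1.2.trans h2.2.symm⟩

theorem IsContinuation.sphericalRat_eq (hq : 2 ≤ residueCard k) {R : RatFunc ℂ}
    (h : IsContinuation σ μ x R) : sphericalRat σ μ x = R := by
  have hex : ∃ R : RatFunc ℂ, IsContinuation σ μ x R := ⟨R, h⟩
  rw [sphericalRat, dif_pos hex]
  exact IsContinuation.unique μ hq hex.choose_spec h

variable [BorelSpace (maxCompact σ 3)] [IsProbabilityMeasure μ] [μ.IsMulLeftInvariant]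

theorem isContinuation (D : UnramifiedData σ q p θ r) (hqk : q = residueCard k)
    (hv : IsSphere σ c v) {m e : ℕ}
    (hc : ‖c‖ = ‖p‖ ^ m) (he : ‖(2 : k')‖ = ‖p‖ ^ e)
    (hx : ∀ h : maxCompact σ 3, ‖act σ (h : GL (Fin 3) k') x 2 2‖ =
      ‖(2 : k')‖ / ‖c‖ * ‖(h : GL (Fin 3) k').val.mulVec v 2‖ ^ 2) :
    IsContinuation σ μ x (continuation q e m) := by
  intro s hs
  rw [← hqk]
  have hq0 : 0 < q := two_pos.trans_le D.two_le
  have hqc : (q : ℂ) ≠ 0 := by exact_mod_cast hq0.ne'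
  have hq3 : (q : ℂ) ^ 3 + 1 ≠ 0 := by exact_mod_cast (by positivity : q ^ 3 + 1 ≠ 0)
  have hW1 := norm_natCast_cpow_ge_one hq0 hs
  have hW0 : (q : ℂ) ^ s ≠ 0 := norm_pos_iff.1 (one_pos.trans_le hW1)
  obtain ⟨U, hU⟩ : ∃ U : ℂ, U * (q : ℂ) ^ 2 * ((q : ℂ) ^ s) ^ 2 = -1 :=
    ⟨-1 / ((q : ℂ) ^ 2 * ((q : ℂ) ^ s) ^ 2), by field_simp⟩
  have hU1 : ‖U‖ ≠ 1 := by
    intro h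
    have h1 := congrArg norm hU
    rw [norm_mul, norm_mul, norm_pow, norm_pow, norm_neg, norm_one, Complex.norm_natCast, h] at h1
    have h2 : 1 ≤ ‖(q : ℂ) ^ s‖ ^ 2 := one_le_pow₀ hW1
    have h3 : 1 < (q : ℝ) ^ 2 := one_lt_pow₀ (by exact_mod_cast D.two_le) two_ne_zero
    nlinarith
  have hUp : 1 + U ≠ 0 := by
    intro h
    rw [eq_neg_of_add_eq_zero_right h, norm_neg, norm_one] at hU1
    exact hU1 rfl
  have hUm : 1 - U ≠ 0 := by
    intro h
    rw [← sub_eq_zero.1 h, norm_one] at hU1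
    exact hU1 rfl
  obtain ⟨h1, h2⟩ := continuation_eval hqc hq3 e m hU hUp
  refine ⟨h1, h2.trans ?_⟩
  rw [integral_absPow μ D hv hc he hx hs hU]
  congr 1
  -- The factor `1 - U` of the denominator cancels here.
  have h3 := sub_mul_symmForm (q : ℂ) 1 U m
  rw [one_pow, one_mul, mul_one] at h3
  rw [← h3, show (1 : ℂ) - U ^ 2 = (1 - U) * (1 + U) by ring]
  field_simp

/-- The shift by `πi/(2 log q)` contributes the factor `i`; this sign change of `q^(2s)` is what
makes `U = q^(2z)` positive for real `z`. -/
theorem cpow_spectral {q : ℕ} (hq : 2 ≤ q) (z : ℂ) :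
    (q : ℂ) ^ (-z - 1 + Real.pi * Complex.I / (2 * Real.log q)) =
      Complex.I * (q : ℂ)⁻¹ * ((q : ℂ) ^ z)⁻¹ := by
  have hqc : (q : ℂ) ≠ 0 := by exact_mod_cast (by omega : q ≠ 0)
  have hlog : (Real.log q : ℂ) ≠ 0 := by
    exact_mod_cast (Real.log_pos (by exact_mod_cast (by omega : 1 < q))).ne'
  rw [Complex.cpow_add _ _ hqc, Complex.cpow_sub _ _ hqc, Complex.cpow_neg, Complex.cpow_one]
  have : (q : ℂ) ^ ((Real.pi : ℂ) * Complex.I / (2 * Real.log q)) = Complex.I := by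
    rw [Complex.cpow_def_of_ne_zero hqc, ← Complex.natCast_log]
    rw [show (Real.log q : ℂ) * ((Real.pi : ℂ) * Complex.I / (2 * Real.log q)) =
      (Real.pi : ℂ) / 2 * Complex.I by field_simp, Complex.exp_pi_div_two_mul_I]
  rw [this]
  ring

theorem omega_eq (D : UnramifiedData σ q p θ r) (hqk : q = residueCard k)
    (hv : IsSphere σ c v) {m e : ℕ}
    (hc : ‖c‖ = ‖p‖ ^ m) (he : ‖(2 : k')‖ = ‖p‖ ^ e)
    (hx : ∀ h : maxCompact σ 3, ‖act σ (h : GL (Fin 3) k') x 2 2‖ =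
      ‖(2 : k')‖ / ‖c‖ * ‖(h : GL (Fin 3) k').val.mulVec v 2‖ ^ 2) (z : ℂ)
    (hz : 1 + ((q : ℂ) ^ z) ^ 2 ≠ 0) :
    omega σ μ x z = (Complex.I * (q : ℂ)⁻¹) ^ ((m : ℤ) - e) / ((q : ℂ) ^ 3 + 1) *
      (((q : ℂ) ^ z) ^ e * (q - ((q : ℂ) ^ z) ^ 2) / (1 + ((q : ℂ) ^ z) ^ 2)) *
        symmForm (q : ℂ) ((q : ℂ) ^ z)⁻¹ ((q : ℂ) ^ z) m := by
  have hq0 : 0 < q := two_pos.trans_le D.two_le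
  have hqc : (q : ℂ) ≠ 0 := by exact_mod_cast hq0.ne'
  have hq3 : (q : ℂ) ^ 3 + 1 ≠ 0 := by exact_mod_cast (by positivity : q ^ 3 + 1 ≠ 0)
  have hV : (q : ℂ) ^ z ≠ 0 := by simp [Complex.cpow_eq_zero_iff, hqc]
  rw [omega, (isContinuation μ D hqk hv hc he hx).sphericalRat_eq μ (hqk ▸ D.two_le), ← hqk,
    cpow_spectral D.two_le]
  set V : ℂ := (q : ℂ) ^ z with hVdef
  rw [(continuation_eval hqc hq3 e m (U := V ^ 2) ?_ hz).2]
  · have h1 : symmForm (q : ℂ) 1 (V ^ 2) m = V ^ m * symmForm (q : ℂ) V⁻¹ V m := by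
      rw [← symmForm_mul, mul_inv_cancel₀ hV, sq]
    rw [h1, mul_zpow, zpow_sub₀ (inv_ne_zero hV), zpow_natCast, zpow_natCast, inv_pow, inv_pow]
    field_simp
  · rw [mul_pow, mul_pow, Complex.I_sq]
    field_simp

end Continuation

end UnitaryHermitian

namespace UnitaryHermitian

/-! ### Elements of `X` as hermitian reflections. -/

theorem two_smul_adjugate_fin_three {K : Type*} [CommRing K] (A : Matrix (Fin 3) (Fin 3) K) :
    (2 : K) • A.adjugate =
      (2 : K) • (A * A) - (2 * A.trace) • A + (A.trace ^ 2 - (A * A).trace) • 1 := by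
  rw [Matrix.adjugate_fin_three]
  ext i j
  fin_cases i <;> fin_cases j <;>
    simp [Matrix.trace_fin_three, Matrix.mul_apply, Fin.sum_univ_three] <;> ring

/-- The entries of the adjugate are, up to sign, the 2 by 2 minors. -/
theorem mul_eq_mul_of_adjugate_eq_zero {K : Type*} [CommRing K] {A : Matrix (Fin 3) (Fin 3) K}
    (hA : A.adjugate = 0) (i j l n : Fin 3) : A i j * A l n = A i n * A l j := by
  have key : ∀ i l j n : Fin 3, i < l → j < n → A i j * A l n = A i n * A l j := by
    rw [Matrix.adjugate_fin_three] at hA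
    have h := fun a b => congrFun (congrFun hA a) b
    have h00 := h 0 0
    have h01 := h 0 1
    have h02 := h 0 2
    have h10 := h 1 0
    have h11 := h 1 1
    have h12 := h 1 2
    have h20 := h 2 0
    have h21 := h 2 1
    have h22 := h 2 2
    simp only [Matrix.of_apply, Matrix.cons_val', Matrix.cons_val, Matrix.zero_apply]
      at h00 h01 h02 h10 h11 h12 h20 h21 h22
    intro i l j n hil hjn
    have hi : (i = 0 ∧ l = 1) ∨ (i = 0 ∧ l = 2) ∨ (i = 1 ∧ l = 2) := by omega
    have hj : (j = 0 ∧ n = 1) ∨ (j = 0 ∧ n = 2) ∨ (j = 1 ∧ n = 2) := by omega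
    rcases hi with ⟨rfl, rfl⟩ | ⟨rfl, rfl⟩ | ⟨rfl, rfl⟩ <;>
    rcases hj with ⟨rfl, rfl⟩ | ⟨rfl, rfl⟩ | ⟨rfl, rfl⟩
    · linear_combination h22
    · linear_combination -h12
    · linear_combination h02
    · linear_combination -h21
    · linear_combination h11
    · linear_combination -h01
    · linear_combination h20
    · linear_combination -h10
    · linear_combination h00
  rcases lt_trichotomy i l with hil | rfl | hil
  · rcases lt_trichotomy j n with hjn | rfl | hjn
    · exact key i l j n hil hjn
    · rfl
    · exact (key i l n j hil hjn).symm
  · exact mul_comm _ _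
  · rcases lt_trichotomy j n with hjn | rfl | hjn
    · rw [mul_comm (A i j), mul_comm (A i n)]
      exact (key l i j n hil hjn).symm
    · rfl
    · rw [mul_comm (A i j), mul_comm (A i n)]
      exact key l i n j hil hjn

/-- An idempotent matrix of trace one has rank one. -/
theorem mul_eq_mul_of_idempotent {K : Type*} [Field K] [NeZero (2 : K)]
    {P : Matrix (Fin 3) (Fin 3) K} (hP : P * P = P) (htr : P.trace = 1) (i j l n : Fin 3) :
    P i j * P l n = P i n * P l j := by
  refine mul_eq_mul_of_adjugate_eq_zero ?_ i j l n
  -- With `P² = P` and trace 1 the right side is `2P - 2P + (1 - 1)`, so the adjugate vanishes.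
  have h := two_smul_adjugate_fin_three P
  rw [hP, htr] at h
  simpa [two_ne_zero] using h

theorem antidiag_mul_self {K : Type*} [CommRing K] : antidiag 3 K * antidiag 3 K = 1 := by
  rw [antidiag_three]
  ext i j
  fin_cases i <;> fin_cases j <;> simp [Matrix.mul_apply, Fin.sum_univ_three]

theorem trace_eq_of_charpoly_eq {K : Type*} [Field K] {A B : Matrix (Fin 3) (Fin 3) K}
    (h : A.charpoly = B.charpoly) : A.trace = B.trace := by
  rw [Matrix.trace_eq_neg_charpoly_coeff, Matrix.trace_eq_neg_charpoly_coeff, h]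

section Reflection

variable {k k' : Type*} [NontriviallyNormedField k] [NormedField k'] [NormedAlgebra k k']

/-- The hermitian matrix attached to the reflection in the vector `v` with `⟨v, v⟩ = c`. -/
def reflMatrix (σ : k' ≃ₐ[k] k') (c : k') (v : Fin 3 → k') : Matrix (Fin 3) (Fin 3) k' :=
  antidiag 3 k' - (2 / c) • Matrix.vecMulVec v fun i => σ (v i)

variable {σ : k' ≃ₐ[k] k'}

theorem mul_antidiag_mul_conjTr {g : GL (Fin 3) k'} (hg : g ∈ unitaryGroup σ 3) :
    g.val * antidiag 3 k' * conjTr σ g.val = antidiag 3 k' := by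
  have hg' : conjTr σ g.val * antidiag 3 k' * g.val = antidiag 3 k' := hg
  have h1 : (antidiag 3 k' * conjTr σ g.val * antidiag 3 k') * g.val = 1 := by
    rw [mul_assoc, mul_assoc, ← mul_assoc (conjTr σ g.val), hg', antidiag_mul_self]
  have h2 := mul_eq_one_comm.1 h1
  calc g.val * antidiag 3 k' * conjTr σ g.val
      = g.val * (antidiag 3 k' * conjTr σ g.val * antidiag 3 k') * antidiag 3 k' := by
        simp only [mul_assoc, antidiag_mul_self, mul_one]
    _ = antidiag 3 k' := by rw [h2, one_mul]

/-- Replaces the action on `X` by the action on vectors. -/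
theorem act_reflMatrix {g : GL (Fin 3) k'} (hg : g ∈ unitaryGroup σ 3) (c : k') (v : Fin 3 → k') :
    act σ g (reflMatrix σ c v) = reflMatrix σ c (g.val.mulVec v) := by
  rw [act, reflMatrix, mul_sub, sub_mul, mul_antidiag_mul_conjTr hg, reflMatrix, Matrix.mul_smul,
    Matrix.smul_mul, Matrix.mul_vecMulVec, Matrix.vecMulVec_mul]
  congr 3
  ext i
  simp [Matrix.vecMul, Matrix.mulVec, dotProduct, conjTr, mul_comm]

theorem norm_reflMatrix {q : ℕ} {p θ : k'} {κ : Type*} [Fintype κ] {r : κ → k'}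
    (D : UnramifiedData σ q p θ r) (c : k') (v : Fin 3 → k') :
    ‖reflMatrix σ c v 2 2‖ = ‖(2 : k')‖ / ‖c‖ * ‖v 2‖ ^ 2 := by
  have h : reflMatrix σ c v 2 2 = -(2 / c * (v 2 * σ (v 2))) := by
    simp [reflMatrix, antidiag_three, Matrix.vecMulVec_apply]
  rw [h, norm_neg, norm_mul, norm_div, D.norm_mul_conj]

variable [IsUltrametricDist k']

theorem norm_hermForm_le {q : ℕ} {p θ : k'} {κ : Type*} [Fintype κ] {r : κ → k'}
    (D : UnramifiedData σ q p θ r) {w : Fin 3 → k'} (hw : ∀ i, ‖w i‖ ≤ 1) :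
    ‖hermForm σ w‖ ≤ 1 := by
  have h : ∀ i j, ‖w i * σ (w j)‖ ≤ 1 := fun i j => by
    rw [norm_mul, D.norm_conj]
    exact mul_le_one₀ (hw i) (norm_nonneg _) (hw j)
  exact norm_add_le_of_le (norm_add_le_of_le (h _ _) (h _ _)) (h _ _)

omit [IsUltrametricDist k'] in
theorem hermForm_smul (t : k') (w : Fin 3 → k') :
    hermForm σ (t • w) = t * σ t * hermForm σ w := by
  simp only [hermForm, Pi.smul_apply, smul_eq_mul, map_mul]
  ring

omit [IsUltrametricDist k'] in
/-- Every element of the space is attached to the reflection in an anisotropic vector. -/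
theorem exists_eq_reflMatrix [CharZero k'] {x : Matrix (Fin 3) (Fin 3) k'}
    (hx : x ∈ hermitianSpace σ 3) :
    ∃ w : Fin 3 → k', hermForm σ w ≠ 0 ∧ x = reflMatrix σ (hermForm σ w) w := by
  obtain ⟨h1, h2, h3⟩ := hx
  rw [h2] at h1
  set J := antidiag 3 k' with hJ
  have hJJ : J * J = 1 := antidiag_mul_self
  have htr := trace_eq_of_charpoly_eq h3
  -- Projection onto the `(-1)`-eigenspace of the involution `xj`.
  set P : Matrix (Fin 3) (Fin 3) k' := (2 : k')⁻¹ • (1 - x * J) with hP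
  have htJ : J.trace = 1 := by simp [hJ, antidiag_three, Matrix.trace_fin_three]
  have hPtr : P.trace = 1 := by
    rw [hP, Matrix.trace_smul, Matrix.trace_sub, htr, htJ, Matrix.trace_one]
    simp
    norm_num
  have hxx : x * J * (x * J) = 1 := by
    rw [← mul_assoc, h1, hJJ]
  have hPP : P * P = P := by
    rw [hP, Matrix.smul_mul, Matrix.mul_smul, smul_smul]
    have : (1 - x * J) * (1 - x * J) = (2 : k') • (1 - x * J) := by
      rw [mul_sub, sub_mul, sub_mul, hxx, two_smul]
      simp only [mul_one, one_mul]
      abel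
    rw [this, smul_smul]
    congr 1
    norm_num
  set H : Matrix (Fin 3) (Fin 3) k' := P * J with hH
  have hHx : x = J - (2 : k') • H := by
    rw [hH, hP, Matrix.smul_mul, smul_smul, mul_inv_cancel₀ two_ne_zero, one_smul, sub_mul,
      mul_assoc, hJJ, one_mul, mul_one, sub_sub_cancel]
  have hHJ : H * J * H = H := by
    rw [hH, mul_assoc P J J, hJJ, mul_one, ← mul_assoc, hPP]
  have hHP : ∀ i j, H i j = P i j.rev := by
    intro i j
    rw [hH, hJ, antidiag_three]
    fin_cases j <;> simp [Matrix.mul_apply, Fin.sum_univ_three, Fin.rev]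
  have hmin : ∀ i j l n, H i j * H l n = H i n * H l j := by
    intro i j l n
    simp only [hHP]
    exact mul_eq_mul_of_idempotent hPP hPtr _ _ _ _
  have hHx' : ∀ i j, x i j = J i j - 2 * H i j := fun i j => by
    conv_lhs => rw [hHx]
    simp
  have hherm : ∀ i j, σ (H i j) = H j i := by
    intro i j
    have e1 : σ (x i j) = x j i := by
      conv_rhs => rw [← h2]
      rfl
    have e2 : σ (J i j) = J j i := by
      rw [hJ, antidiag_three]
      fin_cases i <;> fin_cases j <;> simp
    rw [hHx', hHx', map_sub, e2, map_mul, map_ofNat] at e1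
    exact mul_left_cancel₀ two_ne_zero (sub_right_injective e1)
  -- If the diagonal of the hermitian rank-one `H` vanished, then `H i j σ(H i j) = H i i H j j = 0`
  -- would give `H = 0`, against `P` having trace 1.
  obtain ⟨i, hi⟩ : ∃ i, H i i ≠ 0 := by
    by_contra! hne
    have hz : H = 0 := by
      ext i j
      have := hmin i j j i
      rw [hne i, zero_mul, ← hherm i j, mul_eq_zero] at this
      rcases this with h | h
      · exact h
      · simpa using h
    have hP0 : P = 0 := by
      rw [← mul_one P, ← hJJ, ← mul_assoc, ← hH, hz, zero_mul]
    rw [hP0, Matrix.trace_zero] at hPtr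
    exact zero_ne_one hPtr
  -- This is the diagonal entry at `i` of `HJH = H`; the vector is the `i`-th column of `H`.
  have hform : hermForm σ (fun l => H l i) = H i i := by
    rw [hermForm]
    simp only [hherm]
    have e := congrFun (congrFun hHJ i) i
    rw [hJ, antidiag_three] at e
    simp only [Matrix.mul_apply, Fin.sum_univ_three] at e
    simp at e
    linear_combination e
  refine ⟨fun l => H l i, by rwa [hform], ?_⟩
  rw [hform, reflMatrix, ← hJ]
  ext l n
  rw [hHx', Matrix.sub_apply, Matrix.smul_apply, Matrix.vecMulVec_apply, hherm, smul_eq_mul,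
    hmin l i i n]
  field_simp

/-- `reflMatrix` is unchanged when the vector is scaled, `c` being scaled by the norm of the factor;
dividing by the largest entry makes the vector primitive. -/
theorem exists_sphere_of_mem [CharZero k'] {q : ℕ} {p θ : k'} {κ : Type*} [Fintype κ]
    {r : κ → k'} (D : UnramifiedData σ q p θ r) {x : Matrix (Fin 3) (Fin 3) k'}
    (hx : x ∈ hermitianSpace σ 3) :
    ∃ (c : k') (v : Fin 3 → k') (m : ℕ), IsSphere σ c v ∧ ‖c‖ = ‖p‖ ^ m ∧
      x = reflMatrix σ c v := by
  obtain ⟨w, hw, hxw⟩ := exists_eq_reflMatrix hx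
  obtain ⟨l, hl⟩ := Finite.exists_max fun i => ‖w i‖
  have hl0 : w l ≠ 0 := by
    intro h0
    have hw0 : ∀ i, w i = 0 := fun i => by
      have := hl i
      rw [h0, norm_zero] at this
      exact norm_le_zero_iff.1 this
    exact hw (by simp [hermForm, hw0])
  have hσl : σ (w l) ≠ 0 := by simpa using hl0
  have hle : ∀ i, ‖((w l)⁻¹ • w) i‖ ≤ 1 := fun i => by
    rw [Pi.smul_apply, smul_eq_mul, norm_mul, norm_inv, inv_mul_eq_div]
    exact div_le_one_of_le₀ (hl i) (norm_nonneg _)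
  have hform : hermForm σ ((w l)⁻¹ • w) ≠ 0 := by
    rw [hermForm_smul]
    simp [hl0, hw]
  obtain ⟨m, hm⟩ := D.norm_eq_pow _ hform (norm_hermForm_le D hle)
  refine ⟨_, (w l)⁻¹ • w, m, ⟨hle, ⟨l, by simp [hl0]⟩, rfl⟩, hm, ?_⟩
  conv_lhs => rw [hxw]
  rw [hermForm_smul, reflMatrix, reflMatrix]
  congr 1
  ext i j
  simp only [Matrix.smul_apply, Matrix.vecMulVec_apply, Pi.smul_apply, smul_eq_mul, map_mul,
    map_inv₀]
  field_simp

end Reflection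

end UnitaryHermitian

namespace UnitaryHermitian

/-! ### The representatives `x_λ` and their vectors. -/

section Representatives

variable {k k' : Type*} [NontriviallyNormedField k] [NormedField k'] [NormedAlgebra k k']
  {σ : k' ≃ₐ[k] k'}

theorem mem_hermitianSpace_of_entries {a b b' d : k'} (ha : σ a = a) (hd : σ d = d)
    (hb : σ b = b') (hb' : σ b' = b) (htr : b + b' = 0) (hdet : b * b' - a * d = -1) :
    !![a, 0, b; 0, 1, 0; b', 0, d] ∈ hermitianSpace σ 3 := by
  have hσ : conjTr σ !![a, 0, b; 0, 1, 0; b', 0, d] = !![a, 0, b; 0, 1, 0; b', 0, d] := by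
    ext i j
    fin_cases i <;> fin_cases j <;> simp [conjTr, ha, hd, hb, hb']
  refine ⟨?_, hσ, ?_⟩
  · rw [hσ, antidiag_three]
    ext i j
    fin_cases i <;> fin_cases j <;> simp [Matrix.mul_apply, Fin.sum_univ_three]
    · linear_combination a * htr
    · linear_combination b * htr - hdet
    · linear_combination b' * htr - hdet
    · linear_combination d * htr
  · have hprod : !![a, 0, b; 0, 1, 0; b', 0, d] * antidiag 3 k' =
        !![b, 0, a; 0, 1, 0; d, 0, b'] := by
      rw [antidiag_three]
      ext i j
      fin_cases i <;> fin_cases j <;> simp [Matrix.mul_apply, Fin.sum_univ_three]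
    have htr' := congrArg Polynomial.C htr
    have hdet' := congrArg Polynomial.C hdet
    simp only [map_add, map_mul, map_sub, map_neg, map_one, map_zero] at htr' hdet'
    rw [hprod, antidiag_three, Matrix.charpoly, Matrix.charpoly, Matrix.det_fin_three,
      Matrix.det_fin_three]
    simp
    linear_combination (Polynomial.X - 1) * hdet' - Polynomial.X * (Polynomial.X - 1) * htr'

variable {q : ℕ} {κ : Type*} [Fintype κ] {r : κ → k'} {ϖ ε : k} {rε : k'}

theorem conj_sqrt [CharZero k'] (D : UnramifiedData σ q (algebraMap k k' ϖ) ((1 + rε) / 2) r) :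
    σ rε = -rε := by
  have h := D.conj_theta
  rw [map_div₀, map_add, map_one, map_ofNat] at h
  field_simp at h
  linear_combination h

theorem xRep_mem [CharZero k'] (D : UnramifiedData σ q (algebraMap k k' ϖ) ((1 + rε) / 2) r)
    (hrε : rε ^ 2 = algebraMap k k' ε) (l : ℤ) : xRep ϖ ε rε l ∈ hermitianSpace σ 3 := by
  have hp : algebraMap k k' ϖ ≠ 0 := D.prime_ne_zero
  have hσ := conj_sqrt D
  rw [xRep]
  split_ifs with hl
  · refine mem_hermitianSpace_of_entries (AlgEquiv.commutes _ _) (AlgEquiv.commutes _ _)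
      (map_zero _) (map_zero _) (add_zero _) ?_
    rw [← map_mul, ← zpow_add₀ (by simpa using hp)]
    simp
  · refine mem_hermitianSpace_of_entries (AlgEquiv.commutes _ _) (AlgEquiv.commutes _ _)
      (by rw [map_neg, hσ, neg_neg]) hσ (neg_add_cancel _) ?_
    rw [map_mul, map_zpow₀, map_zpow₀, map_sub, map_one, ← hrε, zpow_neg]
    have := zpow_ne_zero l hp
    field_simp
    ring

/-- The vector is `(s ϖ^l, 0, -1)` with `s` of trace 2, so `c = -2 ϖ^l` and `m = l + e`. The entries
of the reflection matrix then involve only `sσ(s)` and `1 - s`. -/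
theorem exists_sphere_xRep [IsUltrametricDist k'] [CharZero k']
    (D : UnramifiedData σ q (algebraMap k k' ϖ) ((1 + rε) / 2) r)
    (hrε : rε ^ 2 = algebraMap k k' ε) {e : ℕ} (he : ‖(2 : k')‖ = ‖algebraMap k k' ϖ‖ ^ e)
    {l : ℤ} (hl : -(e : ℤ) ≤ l) :
    ∃ (c : k') (v : Fin 3 → k') (m : ℕ), (m : ℤ) - e = l ∧ IsSphere σ c v ∧
      ‖c‖ = ‖algebraMap k k' ϖ‖ ^ m ∧ xRep ϖ ε rε l = reflMatrix σ c v := by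
  have hp : algebraMap k k' ϖ ≠ 0 := D.prime_ne_zero
  set p := algebraMap k k' ϖ with hpdef
  have hpl := zpow_ne_zero l hp
  have hσ := conj_sqrt D
  obtain ⟨m, hm⟩ : ∃ m : ℕ, (m : ℤ) = l + e := ⟨(l + e).toNat, by omega⟩
  have hnorm : ‖-(2 * p ^ l)‖ = ‖p‖ ^ m := by
    rw [norm_neg, norm_mul, he, norm_zpow, ← zpow_natCast, ← zpow_natCast,
      ← zpow_add₀ D.prime_pos.ne', hm, add_comm]
  have hz : ∀ a : ℤ, 0 ≤ a → ‖p‖ ^ a ≤ 1 := fun a ha => by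
    lift a to ℕ using ha
    rw [zpow_natCast]
    exact D.pow_le_one a
  have hσp : σ (p ^ l) = p ^ l := by rw [map_zpow₀, D.conj_prime]
  have hsphere : ∀ s : k', s + σ s = 2 → ‖s * p ^ l‖ ≤ 1 →
      IsSphere σ (-(2 * p ^ l)) ![s * p ^ l, 0, -1] := by
    intro s hs hle
    refine ⟨fun i => ?_, ⟨2, by simp⟩, ?_⟩
    · fin_cases i
      · exact hle
      · simp
      · simp
    · simp only [hermForm, Matrix.cons_val, map_neg, map_one, map_zero, map_mul, hσp]
      linear_combination -(p ^ l) * hs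
  have h2 : 2 / (-(2 * p ^ l)) = -(p ^ l)⁻¹ := by field_simp
  by_cases h : 0 ≤ l
  · refine ⟨_, ![1 * p ^ l, 0, -1], m, by omega, hsphere 1 (by rw [map_one]; norm_num) ?_,
      hnorm, ?_⟩
    · rw [one_mul, norm_zpow]
      exact hz l h
    · rw [xRep, if_pos h, reflMatrix, h2, antidiag_three, map_zpow₀, map_zpow₀, ← hpdef, zpow_neg]
      ext i j
      rw [Matrix.sub_apply, Matrix.smul_apply, Matrix.vecMulVec_apply, smul_eq_mul]
      fin_cases i <;> fin_cases j <;> simp [D.conj_prime, hpl]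
  -- For `l < 0` the choice `s = 1 + rε = 2θ` supplies the factor 2 that keeps `s ϖ^l` integral down
  -- to `l = -e`; its norm is `1 - ε`.
  · refine ⟨_, ![(1 + rε) * p ^ l, 0, -1], m, by omega, hsphere (1 + rε) ?_ ?_, hnorm, ?_⟩
    · rw [map_add, map_one, hσ]; ring
    · have h3 : 1 + rε = 2 * ((1 + rε) / 2) := by field_simp
      rw [h3, norm_mul, norm_mul, he, norm_zpow, mul_right_comm, ← zpow_natCast,
        ← zpow_add₀ D.prime_pos.ne']
      exact mul_le_one₀ (hz _ (by omega))
        (norm_nonneg _) D.norm_theta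
    · rw [xRep, if_neg h, reflMatrix, h2, antidiag_three, map_mul, map_zpow₀, map_zpow₀, map_sub,
        map_one, ← hrε, ← hpdef, zpow_neg]
      ext i j
      rw [Matrix.sub_apply, Matrix.smul_apply, Matrix.vecMulVec_apply, smul_eq_mul]
      fin_cases i <;> fin_cases j <;> simp [D.conj_prime, hσ]
      · field_simp
        ring
      · field_simp
        ring
      · field_simp
        ring

end Representatives

/-! ### The explicit formula and its consequences. -/

theorem explicit_formula {q V J A : ℂ} (hq : q ≠ 0) (hq3 : q ^ 3 + 1 ≠ 0) (hV : V ≠ 0)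
    (h1 : 1 + V ^ 2 ≠ 0) (h2 : 1 - V ^ 2 ≠ 0) (m e : ℕ) :
    J * A / (q ^ 3 + 1) * (V ^ e * (q - V ^ 2) / (1 + V ^ 2)) * symmForm q V⁻¹ V m =
      J * A * V ^ e * (1 - q⁻¹ * V ^ 2) / ((1 + (q ^ 3)⁻¹) * (1 + V ^ 2)) *
        ((V ^ m)⁻¹ * (1 + (q ^ 2)⁻¹ * V ^ 2) / (1 - V ^ 2) +
          V ^ m * (1 + (q ^ 2)⁻¹ * (V ^ 2)⁻¹) / (1 - (V ^ 2)⁻¹)) := by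
  have h3 : V⁻¹ - V ≠ 0 := by
    rw [show V⁻¹ - V = V⁻¹ * (1 - V ^ 2) by field_simp]
    exact mul_ne_zero (inv_ne_zero hV) h2
  have h4 : symmForm q V⁻¹ V m = (V⁻¹ ^ m * (q ^ 2 * V⁻¹ + V) - V ^ m * (q ^ 2 * V + V⁻¹)) /
      (V⁻¹ - V) := by
    rw [eq_div_iff h3, mul_comm, sub_mul_symmForm]
  have h5 : 1 - (V ^ 2)⁻¹ = -((V ^ 2)⁻¹ * (1 - V ^ 2)) := by field_simp; ring
  have h6 : V⁻¹ - V = V⁻¹ * (1 - V ^ 2) := by field_simp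
  have h7 : 1 + (q ^ 3)⁻¹ = (q ^ 3)⁻¹ * (q ^ 3 + 1) := by field_simp
  rw [h4, h5, h6, h7, inv_pow]
  field_simp
  ring

end UnitaryHermitian

theorem proposition2p3
    -- a `p`-adic field `k` with its normalized absolute value and a prime element `ϖ`
    {k : Type*} [NontriviallyNormedField k] [IsUltrametricDist k] [LocallyCompactSpace k]
    [CharZero k]
    (q : ℕ) (hq : q = UnitaryHermitian.residueCard k)
    (ϖ : UnitaryHermitian.integers k) (hϖ : Irreducible ϖ) (hnorm : ‖(ϖ : k)‖ = (q : ℝ)⁻¹)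
    -- `e` is the valuation of `2`
    (e : ℕ) (he : ‖(2 : k)‖ = ‖(ϖ : k)‖ ^ e) (he1 : e ≤ 1)
    -- an unramified quadratic extension `k'` of `k` and its nontrivial automorphism
    {k' : Type*} [NormedField k'] [IsUltrametricDist k'] [NormedAlgebra k k']
    (hdim : Module.finrank k k' = 2) (hunram : ∀ y : k', ∃ x : k, ‖x‖ = ‖y‖)
    (σ : k' ≃ₐ[k] k') (hσ : σ ≠ AlgEquiv.refl)
    -- a unit `ε` such that `1, (1 + √ε) / 2` is an integral basis
    (ε : k) (hε : ‖ε‖ = 1) (rε : k') (hrε : rε ^ 2 = algebraMap k k' ε)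
    (hbasis : ∀ y : k', ‖y‖ ≤ 1 ↔
      ∃! p : UnitaryHermitian.integers k × UnitaryHermitian.integers k,
        y = algebraMap k k' p.1 + algebraMap k k' p.2 * ((1 + rε) / 2))
    -- the normalized Haar measure of `K`
    [MeasurableSpace (UnitaryHermitian.maxCompact σ 3)]
    [BorelSpace (UnitaryHermitian.maxCompact σ 3)]
    (μ : Measure (UnitaryHermitian.maxCompact σ 3)) [μ.IsHaarMeasure] [IsProbabilityMeasure μ] :
    -- the integral converges absolutely and has a unique rational continuation
    (∀ x ∈ UnitaryHermitian.hermitianSpace σ 3,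
      (∀ s : ℂ, 0 ≤ s.re → Integrable (fun h : UnitaryHermitian.maxCompact σ 3 =>
        UnitaryHermitian.absPow (UnitaryHermitian.act σ (h : GL (Fin 3) k') x) s) μ) ∧
      ∃! R : RatFunc ℂ, UnitaryHermitian.IsContinuation σ μ x R) ∧
    -- the explicit formula
    (∀ l : ℤ, -(e : ℤ) ≤ l →
      UnitaryHermitian.xRep (ϖ : k) ε rε l ∈ UnitaryHermitian.hermitianSpace σ 3 ∧
      ∀ z : ℂ, 1 + (q : ℂ) ^ (2 * z) ≠ 0 → 1 - (q : ℂ) ^ (2 * z) ≠ 0 →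
        UnitaryHermitian.omega σ μ (UnitaryHermitian.xRep (ϖ : k) ε rε l) z =
          Complex.I ^ l * (q : ℂ) ^ (-l) * (q : ℂ) ^ (e * z) * (1 - (q : ℂ) ^ (-1 + 2 * z)) /
              ((1 + (q : ℂ) ^ (-3 : ℤ)) * (1 + (q : ℂ) ^ (2 * z))) *
            ((q : ℂ) ^ (-(l + e) * z) * (1 + (q : ℂ) ^ (-2 + 2 * z)) / (1 - (q : ℂ) ^ (2 * z)) +
              (q : ℂ) ^ ((l + e) * z) * (1 + (q : ℂ) ^ (-2 - 2 * z)) /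
                (1 - (q : ℂ) ^ (-2 * z)))) ∧
    -- the consequences for every `x`
    (∀ x ∈ UnitaryHermitian.hermitianSpace σ 3,
      (∃ P : Polynomial ℂ, ∀ z : ℂ, 1 + (q : ℂ) ^ (2 * z) ≠ 0 →
        1 - (q : ℂ) ^ (-1 + 2 * z) ≠ 0 →
        (q : ℂ) ^ (-e * z) * (1 + (q : ℂ) ^ (2 * z)) / (1 - (q : ℂ) ^ (-1 + 2 * z)) *
            UnitaryHermitian.omega σ μ x z =
          P.eval ((q : ℂ) ^ z + (q : ℂ) ^ (-z))) ∧
      ∀ z : ℂ, 1 + (q : ℂ) ^ (2 * z) ≠ 0 → (q : ℂ) ^ (2 * z) - (q : ℂ) ^ (-1 : ℤ) ≠ 0 →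
        UnitaryHermitian.omega σ μ x z =
          (q : ℂ) ^ (2 * e * z) *
              ((1 - (q : ℂ) ^ (-1 + 2 * z)) / ((q : ℂ) ^ (2 * z) - (q : ℂ) ^ (-1 : ℤ))) *
            UnitaryHermitian.omega σ μ x (-z)) := by
  open UnitaryHermitian in
  -- `q = 0` would give `|ϖ| = 0⁻¹ = 0`. Since `Nat.card` is 0 on infinite types, `q ≠ 0` also gives
  -- finiteness of the residue field.
  have hq0 : q ≠ 0 := by
    rintro rfl
    rw [Nat.cast_zero, inv_zero, norm_eq_zero] at hnorm
    exact hϖ.ne_zero (Subtype.ext hnorm)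
  have hfin : Finite (IsLocalRing.ResidueField (integers k)) :=
    Nat.finite_of_card_ne_zero (by rw [← residueCard, ← hq]; exact hq0)
  have := Fintype.ofFinite (IsLocalRing.ResidueField (integers k))
  have : CharZero k' := charZero_of_injective_algebraMap (algebraMap k k').injective
  have D := unramifiedData q hq ϖ hϖ hnorm hunram σ hσ ε hε rε hrε hbasis
  have he' : ‖(2 : k')‖ = ‖algebraMap k k' ϖ‖ ^ e := by
    rw [norm_algebraMap_eq, ← he, ← norm_algebraMap_eq (k' := k'), map_ofNat]
  have hqc : (q : ℂ) ≠ 0 := by exact_mod_cast hq0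
  have hq3 : (q : ℂ) ^ 3 + 1 ≠ 0 := by exact_mod_cast (by positivity : q ^ 3 + 1 ≠ 0)
  have hact : ∀ (c : k') (v : Fin 3 → k') (h : maxCompact σ 3),
      ‖act σ (h : GL (Fin 3) k') (reflMatrix σ c v) 2 2‖ =
        ‖(2 : k')‖ / ‖c‖ * ‖(h : GL (Fin 3) k').val.mulVec v 2‖ ^ 2 := by
    intro c v h
    rw [act_reflMatrix h.2.1, norm_reflMatrix D]
  have hV : ∀ z : ℂ, (q : ℂ) ^ z ≠ 0 := fun z => by simp [Complex.cpow_eq_zero_iff, hqc]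
  have hV2 : ∀ z : ℂ, (q : ℂ) ^ (2 * z) = ((q : ℂ) ^ z) ^ 2 := fun z => by
    rw [← Complex.cpow_nat_mul]; norm_num
  have hV3 : ∀ z : ℂ, (q : ℂ) ^ (-1 + 2 * z) = (q : ℂ)⁻¹ * ((q : ℂ) ^ z) ^ 2 := fun z => by
    rw [Complex.cpow_add _ _ hqc, hV2, Complex.cpow_neg, Complex.cpow_one]
  refine ⟨fun x hx => ?_, fun l hl => ⟨xRep_mem D hrε l, fun z hz1 hz2 => ?_⟩, fun x hx => ?_⟩
  · obtain ⟨c, v, m, hv, hc, rfl⟩ := exists_sphere_of_mem D hx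
    refine ⟨fun s hs => integrable_absPow μ hv (by positivity) (hact c v) hs,
      _, isContinuation μ D hq hv hc he' (hact c v), fun R hR => ?_⟩
    exact hR.unique μ (hq ▸ D.two_le) (isContinuation μ D hq hv hc he' (hact c v))
  · obtain ⟨c, v, m, hml, hv, hc, hx⟩ := exists_sphere_xRep D hrε he' hl
    rw [hV2] at hz1 hz2
    rw [hx, omega_eq μ D hq hv hc he' (hact c v) z hz1, hml, mul_zpow, inv_zpow', hV2, hV3,
      explicit_formula hqc hq3 (hV z) hz1 hz2]
    have e1 : (q : ℂ) ^ ((e : ℂ) * z) = ((q : ℂ) ^ z) ^ e := by rw [Complex.cpow_nat_mul]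
    have e2 : ((l : ℂ) + e) = m := by
      rw [← hml]; push_cast; ring
    have e3 : (q : ℂ) ^ ((m : ℂ) * z) = ((q : ℂ) ^ z) ^ m := by rw [Complex.cpow_nat_mul]
    have e4 : (q : ℂ) ^ (-2 + 2 * z) = ((q : ℂ) ^ 2)⁻¹ * ((q : ℂ) ^ z) ^ 2 := by
      rw [Complex.cpow_add _ _ hqc, hV2, Complex.cpow_neg, Complex.cpow_ofNat]
    have e5 : (q : ℂ) ^ (-2 * z) = (((q : ℂ) ^ z) ^ 2)⁻¹ := by
      rw [neg_mul, Complex.cpow_neg, hV2]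
    have e6 : (q : ℂ) ^ (-2 - 2 * z) = ((q : ℂ) ^ 2)⁻¹ * (((q : ℂ) ^ z) ^ 2)⁻¹ := by
      rw [sub_eq_add_neg, Complex.cpow_add _ _ hqc, Complex.cpow_neg, Complex.cpow_neg, hV2,
        Complex.cpow_ofNat]
    have e7 : (q : ℂ) ^ (-3 : ℤ) = ((q : ℂ) ^ 3)⁻¹ := by
      rw [zpow_neg]; norm_cast
    rw [e1, e2, e4, e5, e6, e7, neg_mul, Complex.cpow_neg, e3]
  · obtain ⟨c, v, m, hv, hc, rfl⟩ := exists_sphere_of_mem D hx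
    have homega := omega_eq μ D hq hv hc he' (hact c v)
    constructor
    · obtain ⟨P, hP⟩ := exists_polynomial_symmForm (q : ℂ) m
      refine ⟨Polynomial.C (q * ((Complex.I * (q : ℂ)⁻¹) ^ ((m : ℤ) - e) / ((q : ℂ) ^ 3 + 1))) * P,
        fun z hz1 hz2 => ?_⟩
      rw [hV2] at hz1
      rw [hV3] at hz2
      have e1 : (q : ℂ) ^ (-(e : ℂ) * z) = (((q : ℂ) ^ z) ^ e)⁻¹ := by
        rw [neg_mul, Complex.cpow_neg, Complex.cpow_nat_mul]
      have hz3 : (q : ℂ) - ((q : ℂ) ^ z) ^ 2 ≠ 0 := by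
        intro h
        apply hz2
        rw [← sub_eq_zero.1 h, inv_mul_cancel₀ hqc, sub_self]
      have hz4 : 1 - (q : ℂ)⁻¹ * ((q : ℂ) ^ z) ^ 2 = (q : ℂ)⁻¹ * (q - ((q : ℂ) ^ z) ^ 2) := by
        field_simp
      rw [homega z hz1, hV2, hV3, e1, Complex.cpow_neg, Polynomial.eval_mul, Polynomial.eval_C,
        add_comm ((q : ℂ) ^ z), hP _ _ (inv_mul_cancel₀ (hV z)), hz4]
      have hVz := hV z
      field_simp
    · intro z hz1 hz2
      have hVz := hV z
      rw [hV2] at hz1 hz2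
      have hz3 : 1 + ((q : ℂ) ^ (-z)) ^ 2 ≠ 0 := by
        rw [Complex.cpow_neg]
        intro h
        apply hz1
        field_simp at h
        linear_combination h
      have e1 : (q : ℂ) ^ (2 * (e : ℂ) * z) = ((q : ℂ) ^ z) ^ (2 * e) := by
        rw [← Complex.cpow_nat_mul]; push_cast; rfl
      have hz4 : ((q : ℂ) ^ z) ^ 2 - (q : ℂ) ^ (-1 : ℤ) =
          (q : ℂ)⁻¹ * (q * ((q : ℂ) ^ z) ^ 2 - 1) := by
        rw [zpow_neg_one]
        field_simp
      have hz5 : (q : ℂ) * ((q : ℂ) ^ z) ^ 2 - 1 ≠ 0 := by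
        intro h
        rw [hz4, h, mul_zero] at hz2
        exact hz2 rfl
      rw [homega z hz1, homega (-z) hz3, hV2, hV3, e1, hz4]
      rw [Complex.cpow_neg] at hz3 ⊢
      -- Passing from `z` to `-z` swaps `V⁻¹` and `V`, which leaves `symmForm` unchanged; only the
      -- elementary prefactors differ.
      rw [inv_inv, symmForm_comm (q : ℂ) ((q : ℂ) ^ z) ((q : ℂ) ^ z)⁻¹]
      have hz6 : 1 + ((q : ℂ) ^ z)⁻¹ ^ 2 = (((q : ℂ) ^ z) ^ 2)⁻¹ * (1 + ((q : ℂ) ^ z) ^ 2) := by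
        field_simp
        ring
      have hz7 : (q : ℂ) - ((q : ℂ) ^ z)⁻¹ ^ 2 =
          (((q : ℂ) ^ z) ^ 2)⁻¹ * (q * ((q : ℂ) ^ z) ^ 2 - 1) := by
        field_simp
      rw [hz6, hz7, inv_pow, pow_mul']
      field_simp
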